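/- An algorithm is a deterministic random access machine program under the logarithmic cost criterion (each instruction costs the number of bits of the numbers it handles). For a problem whose instances $x$ carry a parameter $\kappa(x)\in\mathbb N$, "solvable in time $O^*(b^{\kappa})$" means that there are an algorithm and constants $C,c\in\mathbb N$ such that the algorithm decides every instance $x$ correctly within time $C\,|x|^{c}\,b^{\kappa(x)}$, where $|x|$ is the bit length of the encoding of $x$. The Strong Exponential Time Hypothesis (SETH) states: for every $\delta>0$ there is an integer $d$ such that $d$-SAT (satisfiability of CNF formulas with at most $d$ literals per clause) cannot be solved in time $O^*((2-\delta)^n)$, where $n$ is the number of variables. A linear arrangement of a finite simple graph $G=(V,E)$ on $n$ vertices is a bijection $\ell:\{1,\dots,n\}\to V$; its cutwidth $\mathrm{ctw}(\ell)$ is the maximum over $i\in\{1,\dots,n\}$ of the number of edges $\{\ell(j),\ell(k)\}\in E$ with $j\le i<k$ (and $0$ if $n=0$), and $\mathrm{ctw}(G)$ is the minimum of $\mathrm{ctw}(\ell)$ over all linear arrangements $\ell$ of $G$. In the Connected Dominating Set problem one is given $G$ and $k\in\mathbb N$ and asks whether there is a nonempty set $S\subseteq V$ with $|S|\le k$ such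 that every vertex outside $S$ has a neighbor in $S$ and the induced subgraph $G[S]$ is connected. **Theorem.** Assume SETH. Then for every real $\varepsilon>0$: 1. there is no algorithm that, given $(G,k)$, solves Connected Dominating Set in time $O^*\big((3-\varepsilon)^{\mathrm{ctw}(G)}\big)$; 2. this remains so if a linear arrangement is given: there is no algorithm that, given $(G,k)$ and a linear arrangement $\ell$ of $G$, solves Connected Dominating Set on $(G,k)$ in time $O^*\big((3-\varepsilon)^{\mathrm{ctw}(\ell)}\big)$. -/

import Mathlib

/-!
# Random access machines with logarithmic cost

Algorithms are deterministic random access machine programs. A machine has registers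
`0, 1, 2, …` and arrays `0, 1, 2, …` (a program mentions only finitely many of them), all holding
natural numbers. The running time is the logarithmic cost: each instruction costs the total
number of bits of the numbers that it handles.
-/

namespace RAM

/-- Number of binary digits of a natural number (one digit for `0`). -/
def bitLen (x : ℕ) : ℕ := Nat.log 2 x + 1

/-- Arithmetic instructions; `sub` is truncated subtraction, `div` and `mod` are quotient and
remainder of integer division. -/
inductive Op : Type
  | add | sub | mul | div | mod

/-- The value of an arithmetic operation. -/
def Op.eval : Op → ℕ → ℕ → ℕ
  | .add, x, y => x + y
  | .sub, x, y => x - y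
  | .mul, x, y => x * y
  | .div, x, y => x / y
  | .mod, x, y => x % y

/-- Programs. The numbers `r`, `a`, `b` are names of registers and `A` is the name of an array. -/
inductive Prog : Type
  /-- `r := c` -/
  | const (r c : ℕ)
  /-- `r := a ∘ b` -/
  | arith (o : Op) (r a b : ℕ)
  /-- `r := A[a]` -/
  | load (r A a : ℕ)
  /-- `A[a] := b` -/
  | store (A a b : ℕ)
  /-- first `p`, then `q` -/
  | seq (p q : Prog)
  /-- if `r ≠ 0` then `p` else `q` -/
  | ite (r : ℕ) (p q : Prog)
  /-- as long as `r ≠ 0`, repeat `p` -/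
  | loop (r : ℕ) (p : Prog)

/-- The contents of all registers and all array cells. -/
structure State where
  /-- contents of the registers -/
  reg : ℕ → ℕ
  /-- `mem A i` is the content of cell `i` of array `A` -/
  mem : ℕ → ℕ → ℕ

/-- Overwrite register `r`. -/
def State.setReg (s : State) (r x : ℕ) : State :=
  { s with reg := Function.update s.reg r x }

/-- Overwrite cell `i` of array `A`. -/
def State.setMem (s : State) (A i x : ℕ) : State :=
  { s with mem := Function.update s.mem A (Function.update (s.mem A) i x) }

/-- `Exec p s t s'`: started in state `s`, the program `p` halts in state `s'`, and the total cost
of the instructions that it executes is `t`. -/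
inductive Exec : Prog → State → ℕ → State → Prop
  | const (s : State) (r c : ℕ) :
      Exec (.const r c) s (bitLen c) (s.setReg r c)
  | arith (s : State) (o : Op) (r a b : ℕ) :
      Exec (.arith o r a b) s (bitLen (s.reg a) + bitLen (s.reg b))
        (s.setReg r (o.eval (s.reg a) (s.reg b)))
  | load (s : State) (r A a : ℕ) :
      Exec (.load r A a) s (bitLen (s.reg a) + bitLen (s.mem A (s.reg a)))
        (s.setReg r (s.mem A (s.reg a)))
  | store (s : State) (A a b : ℕ) :
      Exec (.store A a b) s (bitLen (s.reg a) + bitLen (s.reg b))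
        (s.setMem A (s.reg a) (s.reg b))
  | seq {p q : Prog} {s s₁ s₂ : State} {t₁ t₂ : ℕ} :
      Exec p s t₁ s₁ → Exec q s₁ t₂ s₂ → Exec (.seq p q) s (t₁ + t₂) s₂
  | ite_true {r : ℕ} {p q : Prog} {s s₁ : State} {t : ℕ} :
      s.reg r ≠ 0 → Exec p s t s₁ → Exec (.ite r p q) s (bitLen (s.reg r) + t) s₁
  | ite_false {r : ℕ} {p q : Prog} {s s₁ : State} {t : ℕ} :
      s.reg r = 0 → Exec q s t s₁ → Exec (.ite r p q) s (bitLen (s.reg r) + t) s₁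
  | loop_true {r : ℕ} {p : Prog} {s s₁ s₂ : State} {t₁ t₂ : ℕ} :
      s.reg r ≠ 0 → Exec p s t₁ s₁ → Exec (.loop r p) s₁ t₂ s₂ →
        Exec (.loop r p) s (bitLen (s.reg r) + t₁ + t₂) s₂
  | loop_false {r : ℕ} {p : Prog} {s : State} :
      s.reg r = 0 → Exec (.loop r p) s (bitLen (s.reg r)) s

/-- The machine is deterministic, so a halting run has one running time and one result. -/
theorem Exec.deterministic {p : Prog} {s s₁ s₂ : State} {t₁ t₂ : ℕ}
    (h₁ : Exec p s t₁ s₁) (h₂ : Exec p s t₂ s₂) : t₁ = t₂ ∧ s₁ = s₂ := by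
  induction h₁ generalizing t₂ s₂ with
  | const => cases h₂; exact ⟨rfl, rfl⟩
  | arith => cases h₂; exact ⟨rfl, rfl⟩
  | load => cases h₂; exact ⟨rfl, rfl⟩
  | store => cases h₂; exact ⟨rfl, rfl⟩
  | seq _ _ ih₁ ih₂ =>
    cases h₂ with
    | seq k₁ k₂ =>
      obtain ⟨rfl, rfl⟩ := ih₁ k₁
      obtain ⟨rfl, rfl⟩ := ih₂ k₂
      exact ⟨rfl, rfl⟩
  | ite_true h _ ih =>
    cases h₂ with
    | ite_true _ k => obtain ⟨rfl, rfl⟩ := ih k; exact ⟨rfl, rfl⟩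
    | ite_false h' _ => exact absurd h' h
  | ite_false h _ ih =>
    cases h₂ with
    | ite_true h' _ => exact absurd h h'
    | ite_false _ k => obtain ⟨rfl, rfl⟩ := ih k; exact ⟨rfl, rfl⟩
  | loop_true h _ _ ih₁ ih₂ =>
    cases h₂ with
    | loop_true _ k₁ k₂ =>
      obtain ⟨rfl, rfl⟩ := ih₁ k₁
      obtain ⟨rfl, rfl⟩ := ih₂ k₂
      exact ⟨rfl, rfl⟩
    | loop_false h' => exact absurd h' h
  | loop_false h =>
    cases h₂ with
    | loop_true h' _ _ => exact absurd h h'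
    | loop_false _ => exact ⟨rfl, rfl⟩

/-- The initial state: the input stands in array `0`, and everything else is `0`. -/
def State.init (input : List ℕ) : State where
  reg _ := 0
  mem A i := if A = 0 then input.getD i 0 else 0

end RAM

/-! # Parameterized decision problems and `O*`-running times -/

/-- A parameterized decision problem together with an encoding of its instances. -/
structure ParamProblem where
  /-- the instances -/
  Inst : Type
  /-- how an instance is written in the memory of a machine -/
  encode : Inst → List ℕ
  /-- the parameter -/
  param : Inst → ℕ
  /-- the yes-instances -/
  IsYes : Inst → Prop

/-- The input size of an instance: the total number of bits of its encoding. -/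
def ParamProblem.size (P : ParamProblem) (x : P.Inst) : ℕ :=
  ((P.encode x).map RAM.bitLen).sum

/-- `P` can be solved in time `O*(b ^ param)`: some machine halts on every instance `x` within
time `C * (size x) ^ c * b ^ (param x)`, for constants `C` and `c`, and accepts (leaves a nonzero
number in register `0`) exactly the yes-instances. -/
def ParamProblem.SolvableInOStar (P : ParamProblem) (b : ℝ) : Prop :=
  ∃ (p : RAM.Prog) (C c : ℕ), ∀ x : P.Inst, ∃ (t : ℕ) (s : RAM.State),
    RAM.Exec p (RAM.State.init (P.encode x)) t s ∧
    (s.reg 0 ≠ 0 ↔ P.IsYes x) ∧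
    (t : ℝ) ≤ (C : ℝ) * (P.size x : ℝ) ^ c * b ^ P.param x

/-! # Satisfiability and the Strong Exponential Time Hypothesis -/

/-- Boolean formulas in conjunctive normal form: a list of clauses, which are lists of literals.
The literal `(v, true)` is the variable `v`, and `(v, false)` is its negation. -/
structure CNFFormula where
  /-- the number of variables -/
  numVars : ℕ
  /-- the clauses -/
  clauses : List (List (Fin numVars × Bool))

/-- Some truth assignment makes a literal of every clause true. -/
def CNFFormula.Satisfiable (φ : CNFFormula) : Prop :=
  ∃ a : Fin φ.numVars → Bool, ∀ C ∈ φ.clauses, ∃ l ∈ C, a l.1 = l.2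

/-- The number of variables, the number of clauses, and then clause by clause the number of
literals and the literals. -/
def CNFFormula.encode (φ : CNFFormula) : List ℕ :=
  φ.numVars :: φ.clauses.length ::
    φ.clauses.flatMap fun C => C.length :: C.map fun l => 2 * (l.1 : ℕ) + l.2.toNat

/-- The problem `d`-SAT (clauses of at most `d` literals), parameterized by the number of
variables. -/
def satProblem (d : ℕ) : ParamProblem where
  Inst := {φ : CNFFormula // ∀ C ∈ φ.clauses, C.length ≤ d}
  encode φ := φ.1.encode
  param φ := φ.1.numVars
  IsYes φ := φ.1.Satisfiable

/-- The Strong Exponential Time Hypothesis: for every `δ > 0` there is some `d` such that `d`-SAT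
cannot be solved in time `O*((2 - δ) ^ n)`. -/
def SETH : Prop :=
  ∀ δ : ℝ, 0 < δ → ∃ d : ℕ, ¬ (satProblem d).SolvableInOStar (2 - δ)

/-! # Cutwidth -/

namespace SimpleGraph

variable {V : Type*} {n : ℕ}

/-- The cut after position `i` of a linear arrangement `ℓ`: the edges that have one end-vertex at a
position `≤ i` and the other one at a position `> i`. -/
def arrangementCut (G : SimpleGraph V) (ℓ : Fin n ≃ V) (i : Fin n) : Set (Sym2 V) :=
  {e ∈ G.edgeSet | ∃ j k : Fin n, j ≤ i ∧ i < k ∧ e = s(ℓ j, ℓ k)}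

/-- The cutwidth of a linear arrangement: the largest number of edges in one of its cuts. -/
noncomputable def arrangementCutwidth (G : SimpleGraph V) (ℓ : Fin n ≃ V) : ℕ :=
  Finset.univ.sup fun i : Fin n => (G.arrangementCut ℓ i).ncard

/-- The cutwidth of a graph: the smallest cutwidth of a linear arrangement. -/
noncomputable def cutwidth (G : SimpleGraph (Fin n)) : ℕ :=
  ⨅ ℓ : Fin n ≃ Fin n, G.arrangementCutwidth ℓ

/-! # Connected dominating sets -/

/-- Every vertex outside `S` has a neighbor in `S`. -/
def IsDominatingSet (G : SimpleGraph V) (S : Set V) : Prop :=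
  ∀ v, v ∉ S → ∃ u ∈ S, G.Adj v u

/-- A dominating set that induces a connected subgraph. -/
def IsConnectedDominatingSet (G : SimpleGraph V) (S : Set V) : Prop :=
  G.IsDominatingSet S ∧ (G.induce S).Connected

open Classical in
/-- The adjacency matrix of a graph, row by row. -/
noncomputable def encodeAdj (G : SimpleGraph (Fin n)) : List ℕ :=
  (List.finRange n).flatMap fun i => (List.finRange n).map fun j => if G.Adj i j then 1 else 0

end SimpleGraph

/-- An instance of Connected Dominating Set: a graph and a number `k`. -/
structure CDSInstance where
  /-- the number of vertices -/
  n : ℕ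
  /-- the graph -/
  graph : SimpleGraph (Fin n)
  /-- the allowed number of vertices of a connected dominating set -/
  k : ℕ

/-- The graph has a connected dominating set of at most `k` vertices. -/
def CDSInstance.IsYes (x : CDSInstance) : Prop :=
  ∃ S : Finset (Fin x.n), x.graph.IsConnectedDominatingSet (S : Set (Fin x.n)) ∧ S.card ≤ x.k

/-- The number of vertices, the number `k`, and the adjacency matrix. -/
noncomputable def CDSInstance.encode (x : CDSInstance) : List ℕ :=
  x.n :: x.k :: x.graph.encodeAdj

/-- Connected Dominating Set, parameterized by the cutwidth of the graph. -/
noncomputable def cdsProblem : ParamProblem where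
  Inst := CDSInstance
  encode x := x.encode
  param x := x.graph.cutwidth
  IsYes x := x.IsYes

/-- Connected Dominating Set with a linear arrangement of the graph as a part of the input,
parameterized by the cutwidth of this arrangement. -/
noncomputable def cdsWithArrangementProblem : ParamProblem where
  Inst := Σ x : CDSInstance, Fin x.n ≃ Fin x.n
  encode x := x.1.encode ++ (List.finRange x.1.n).map fun i => (x.2 i : ℕ)
  param x := x.1.graph.arrangementCutwidth x.2
  IsYes x := x.1.IsYes

/-! A formula with `n` variables and clauses of bounded length becomes a graph of cutwidth about `n
* log_3 2`, so that an algorithm with base below `3` would give one for satisfiability with base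
below `2`. The variables are divided into groups of `t`, and an assignment to a group is written in
base three on `p` rows, where `2 ^ t ≤ 3 ^ p`. A row has three possible states but sends only one
edge from each column to the next.

Between two consecutive columns, a row is a path: vertices `4`, `5` of the left block, then `3`, `2`
of the right block, with both ends attached to a backbone path of roots. Pendant vertices force the
roots into a connected dominating set. The neighborhoods of the pendant vertices, of the two middle
vertices of every row path, and of vertex `2` of every selector are pairwise disjoint, and their
number is the budget. Hence a solution within the budget takes exactly one vertex from each
(`SimpleGraph.eq_of_adj_of_card_le`, `Layout.lab_eq_of_edge`). It cannot take both middle vertices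
of a row path, as these would be cut off from the roots. State `2` means that `5` is taken, state
`0` that `3` is taken, and state `1` that neither is.

Comparison vertices make the state of a row nondecreasing from column to column. In every inner
column a clause vertex forces some active selector to be selected, and the check vertices of this
selector then squeeze its digits between the states to the left and to the right
(`Layout.exists_states`). All `m` clauses are repeated `2 * R + 1` times. Since the sum of the
states of the `R` rows never decreases and is at most `2 * R`, some repetition leaves all states
unchanged; there the states spell one assignment that satisfies every clause. Conversely, a
satisfying assignment gives constant states and a solution within the budget
(`Layout.exists_isConnectedDominatingSet`). In the order of the vertex numbers a cut contains at
most one edge of each row and boundedly many others (`Layout.arrangementCutwidth_le`).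

On the machine side, every cell of the output is the value of one fixed arithmetic term of its
address. Such terms compile to programs that are polynomial in the largest input number
(`RAM.Term.exec_compile`), which yields the reduction principle
`ParamProblem.SolvableInOStar.of_fill`. The arithmetic of the bases is done in
`exists_pow_le_pow_of_lt_three` and `SETH.not_solvableInOStar`. -/

namespace RAM

/-! # Compiling terms to random access machine programs -/

/-- Terms over one variable and a read-only input array. -/
inductive Term : Type
  | var
  | const (c : ℕ)
  | op (o : Op) (e f : Term)
  | inp (e : Term)
  /-- start at cell `2` and jump over the current cell and the number of cells it announces,
  `e` times -/
  | start (e : Term)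

/-- The value of a term, where `w` is the input and `a` the value of the variable. -/
def Term.eval (w : ℕ → ℕ) (a : ℕ) : Term → ℕ
  | .var => a
  | .const c => c
  | .op o e f => o.eval (e.eval w a) (f.eval w a)
  | .inp e => w (e.eval w a)
  | .start e => (fun q => q + 1 + w q)^[e.eval w a] 2

/-- One step of the evaluation of `Term.start`, with the number of remaining steps in slot `k` and
the current cell in slot `k + 1`. -/
def startBody (k : ℕ) : Prog :=
  .seq (.load (2 * k + 5) 0 (2 * k + 3))
    (.seq (.arith .add (2 * k + 3) (2 * k + 3) (2 * k + 5))
      (.seq (.arith .add (2 * k + 3) (2 * k + 3) (2 * k + 7))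
        (.arith .sub (2 * k + 1) (2 * k + 1) (2 * k + 7))))

/-- A program that computes a term. Slot `k` is register `2 * k + 1`; the variable is in slot `0`,
the result goes to slot `k`, and the slots from `k` on are overwritten. -/
def Term.compile (k : ℕ) : Term → Prog
  | .var => .seq (.const (2 * k + 1) 0) (.arith .add (2 * k + 1) 1 (2 * k + 1))
  | .const c => .const (2 * k + 1) c
  | .op o e f => .seq (e.compile k)
      (.seq (f.compile (k + 1)) (.arith o (2 * k + 1) (2 * k + 1) (2 * k + 3)))
  | .inp e => .seq (e.compile k) (.load (2 * k + 1) 0 (2 * k + 1))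
  | .start e => .seq (e.compile k)
      (.seq (.const (2 * k + 3) 2) (.seq (.const (2 * k + 7) 1)
        (.seq (.loop (2 * k + 1) (startBody k))
          (.arith .add (2 * k + 1) (2 * k + 1) (2 * k + 3)))))

theorem bitLen_le_succ (x : ℕ) : bitLen x ≤ x + 1 :=
  Nat.succ_le_succ (Nat.log_le_self 2 x)

theorem one_le_bitLen (x : ℕ) : 1 ≤ bitLen x := Nat.succ_le_succ (Nat.zero_le _)

theorem bitLen_mono {x y : ℕ} (h : x ≤ y) : bitLen x ≤ bitLen y :=
  Nat.succ_le_succ (Nat.log_mono_right h)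

theorem pow_le_pow_of_two_le {B a b : ℕ} (hB : 2 ≤ B) (h : a ≤ b) : B ^ a ≤ B ^ b :=
  Nat.pow_le_pow_right (by omega) h

theorem le_pow_self_of_two_le {B : ℕ} (hB : 2 ≤ B) (c : ℕ) : c ≤ B ^ c :=
  (Nat.lt_pow_self hB).le

theorem add_le_pow {B x y a b : ℕ} (hB : 2 ≤ B) (hx : x ≤ B ^ a) (hy : y ≤ B ^ b) :
    x + y ≤ B ^ (a + b + 1) := by
  have h₁ : B ^ a ≤ B ^ (a + b) := pow_le_pow_of_two_le hB (by omega)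
  have h₂ : B ^ b ≤ B ^ (a + b) := pow_le_pow_of_two_le hB (by omega)
  have h₃ : B ^ (a + b) * 2 ≤ B ^ (a + b) * B := Nat.mul_le_mul_left _ hB
  rw [pow_succ]
  omega

theorem mul_le_pow {B x y a b : ℕ} (hx : x ≤ B ^ a) (hy : y ≤ B ^ b) :
    x * y ≤ B ^ (a + b) := by
  rw [pow_add]
  exact Nat.mul_le_mul hx hy

theorem bitLen_le_pow {B x a : ℕ} (hB : 2 ≤ B) (hx : x ≤ B ^ a) : bitLen x ≤ B ^ (a + 1) := by
  have h := add_le_pow (b := 0) hB hx (le_refl 1)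
  exact (bitLen_le_succ x).trans h

theorem Op.eval_le_pow {B x y a b : ℕ} (hB : 2 ≤ B) (o : Op) (hx : x ≤ B ^ a) (hy : y ≤ B ^ b) :
    o.eval x y ≤ B ^ (a + b + 1) := by
  have hx' : x ≤ B ^ (a + b + 1) := hx.trans (pow_le_pow_of_two_le hB (by omega))
  cases o with
  | add => exact add_le_pow hB hx hy
  | sub => exact (Nat.sub_le x y).trans hx'
  | mul => exact (mul_le_pow hx hy).trans (pow_le_pow_of_two_le hB (by omega))
  | div => exact (Nat.div_le_self x y).trans hx'
  | mod => exact (Nat.mod_le x y).trans hx'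

theorem iterate_start_le {w : ℕ → ℕ} {B : ℕ} (hw : ∀ i, w i ≤ B) (j q : ℕ) :
    (fun q => q + 1 + w q)^[j] q ≤ q + j * (B + 1) := by
  induction j generalizing q with
  | zero => simp
  | succ j ih =>
    have h₁ := ih (q + 1 + w q)
    have h₂ := hw q
    rw [Function.iterate_succ_apply, Nat.succ_mul]
    omega

/-- `X` bounds every number that occurs. A round consists of one test and four instructions that
handle two numbers each, hence the nine bit lengths. -/
theorem exec_startLoop {w : ℕ → ℕ} {B X : ℕ} (hw : ∀ i, w i ≤ B) (_ : B + 1 ≤ X) (k : ℕ) :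
    ∀ (j q : ℕ) (σ : State), σ.mem 0 = w → σ.reg (2 * k + 1) = j → σ.reg (2 * k + 3) = q →
      σ.reg (2 * k + 7) = 1 → j ≤ X → q + j * (B + 1) ≤ X →
      ∃ t σ', Exec (.loop (2 * k + 1) (startBody k)) σ t σ' ∧ t ≤ (j + 1) * (9 * bitLen X) ∧
        σ'.mem = σ.mem ∧ σ'.reg (2 * k + 1) = 0 ∧
        σ'.reg (2 * k + 3) = (fun q => q + 1 + w q)^[j] q ∧
        ∀ r, r % 2 = 0 ∨ r < 2 * k + 1 → σ'.reg r = σ.reg r := by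
  intro j
  induction j with
  | zero =>
    intro q σ hm h1 h3 h7 _ _
    refine ⟨_, σ, Exec.loop_false h1, ?_, rfl, h1, h3, fun _ _ => rfl⟩
    rw [h1]
    have := bitLen_mono (Nat.zero_le X)
    omega
  | succ j ih =>
    intro q σ hm h1 h3 h7 hj hq
    rw [Nat.succ_mul] at hq
    have hwq := hw q
    have E1 := Exec.load σ (2 * k + 5) 0 (2 * k + 3)
    set σ1 := σ.setReg (2 * k + 5) (σ.mem 0 (σ.reg (2 * k + 3))) with e1
    have E2 := Exec.arith σ1 .add (2 * k + 3) (2 * k + 3) (2 * k + 5)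
    set σ2 := σ1.setReg (2 * k + 3) (Op.add.eval (σ1.reg (2 * k + 3)) (σ1.reg (2 * k + 5))) with e2
    have E3 := Exec.arith σ2 .add (2 * k + 3) (2 * k + 3) (2 * k + 7)
    set σ3 := σ2.setReg (2 * k + 3) (Op.add.eval (σ2.reg (2 * k + 3)) (σ2.reg (2 * k + 7))) with e3
    have E4 := Exec.arith σ3 .sub (2 * k + 1) (2 * k + 1) (2 * k + 7)
    set σ4 := σ3.setReg (2 * k + 1) (Op.sub.eval (σ3.reg (2 * k + 1)) (σ3.reg (2 * k + 7))) with e4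
    have a3 : σ1.reg (2 * k + 3) = q := by simp [e1, State.setReg, h3]
    have a5 : σ1.reg (2 * k + 5) = w q := by simp [e1, State.setReg, h3, hm]
    have b3 : σ2.reg (2 * k + 3) = q + w q := by simp [e2, State.setReg, a3, a5, Op.eval]
    have b7 : σ2.reg (2 * k + 7) = 1 := by simp [e2, e1, State.setReg, h7]
    have c3 : σ3.reg (2 * k + 3) = q + 1 + w q := by
      simp [e3, State.setReg, b3, b7, Op.eval]; omega
    have c1 : σ3.reg (2 * k + 1) = j + 1 := by simp [e3, e2, e1, State.setReg, h1]
    have c7 : σ3.reg (2 * k + 7) = 1 := by simp [e3, State.setReg, b7]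
    have d1 : σ4.reg (2 * k + 1) = j := by simp [e4, State.setReg, c1, c7, Op.eval]
    have d3 : σ4.reg (2 * k + 3) = q + 1 + w q := by simp [e4, State.setReg, c3]
    have d7 : σ4.reg (2 * k + 7) = 1 := by simp [e4, State.setReg, c7]
    have dm : σ4.mem = σ.mem := rfl
    have dr : ∀ r, r % 2 = 0 ∨ r < 2 * k + 1 → σ4.reg r = σ.reg r := by
      intro r hr
      have : r ≠ 2 * k + 1 ∧ r ≠ 2 * k + 3 ∧ r ≠ 2 * k + 5 := by omega
      simp [e4, e3, e2, e1, State.setReg, this]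
    obtain ⟨t, σ', hE, ht, hmem, z1, z3, zr⟩ := ih (q + 1 + w q) σ4 (by rw [dm, hm]) d1 d3 d7
      (by omega) (by omega)
    refine ⟨_, σ', Exec.loop_true (by omega) (Exec.seq E1 (Exec.seq E2 (Exec.seq E3 E4))) hE, ?_,
      by rw [hmem, dm], z1, by rw [z3, Function.iterate_succ_apply],
      fun r hr => by rw [zr r hr, dr r hr]⟩
    rw [h1, h3, hm, a3, a5, b3, b7, c1, c7]
    have m1 := bitLen_mono (show j + 1 ≤ X by omega)
    have m2 := bitLen_mono (show q ≤ X by omega)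
    have m3 := bitLen_mono (show w q ≤ X by omega)
    have m4 := bitLen_mono (show q + w q ≤ X by omega)
    have m5 := bitLen_mono (show 1 ≤ X by omega)
    rw [Nat.succ_mul]
    omega

/-- Terms have values of polynomial size and are evaluated in polynomial time. -/
theorem Term.exec_compile (e : Term) : ∃ c : ℕ, ∀ (B : ℕ) (w : ℕ → ℕ) (a : ℕ), 2 ≤ B →
    (∀ i, w i ≤ B) → a ≤ B → e.eval w a ≤ B ^ c ∧
    ∀ (k : ℕ) (σ : State), 1 ≤ k → σ.mem 0 = w → σ.reg 1 = a →
      ∃ t σ', Exec (e.compile k) σ t σ' ∧ t ≤ B ^ c ∧ σ'.mem = σ.mem ∧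
        σ'.reg (2 * k + 1) = e.eval w a ∧
        ∀ r, r % 2 = 0 ∨ r < 2 * k + 1 → σ'.reg r = σ.reg r := by
  induction e with
  | var =>
    refine ⟨6, fun B w a hB hw ha => ⟨ha.trans (Nat.le_self_pow (by omega) B), ?_⟩⟩
    intro k σ hk hm h1
    have E1 := Exec.const σ (2 * k + 1) 0
    have E2 := Exec.arith (σ.setReg (2 * k + 1) 0) .add (2 * k + 1) 1 (2 * k + 1)
    refine ⟨_, _, E1.seq E2, ?_, rfl, ?_, ?_⟩
    · have h0 : bitLen 0 ≤ B ^ 1 := bitLen_le_pow hB (a := 0) (by simp)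
      have h2 : bitLen a ≤ B ^ 2 := bitLen_le_pow hB (a := 1) (by simpa using ha)
      have := add_le_pow hB h0 (add_le_pow hB h2 h0)
      simpa [State.setReg, Function.update_apply, Nat.one_le_iff_ne_zero.mp hk, h1] using this
    · simp [State.setReg, Nat.one_le_iff_ne_zero.mp hk, h1, Op.eval, Term.eval]
    · intro r hr
      have : r ≠ 2 * k + 1 := by omega
      simp [State.setReg, this]
  | const c =>
    refine ⟨c + 1, fun B w a hB hw ha => ⟨(le_pow_self_of_two_le hB c).trans
      (pow_le_pow_of_two_le hB (by omega)), ?_⟩⟩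
    intro k σ hk hm h1
    refine ⟨_, _, Exec.const σ (2 * k + 1) c, bitLen_le_pow hB (le_pow_self_of_two_le hB c), rfl,
      ?_, ?_⟩
    · simp [State.setReg, Term.eval]
    · intro r hr
      have : r ≠ 2 * k + 1 := by omega
      simp [State.setReg, this]
  | op o e f ihe ihf =>
    obtain ⟨c, hc⟩ := ihe
    obtain ⟨d, hd⟩ := ihf
    refine ⟨c + (d + ((c + 1) + (d + 1) + 1) + 1) + 1, fun B w a hB hw ha => ?_⟩
    obtain ⟨ve, He⟩ := hc B w a hB hw ha
    obtain ⟨vf, Hf⟩ := hd B w a hB hw ha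
    refine ⟨(Op.eval_le_pow hB o ve vf).trans (pow_le_pow_of_two_le hB (by omega)), ?_⟩
    intro k σ hk hm h1
    obtain ⟨t, σ1, E1, T1, M1, V1, R1⟩ := He k σ hk hm h1
    obtain ⟨u, σ2, E2, T2, M2, V2, R2⟩ := Hf (k + 1) σ1 (by omega) (by rw [M1, hm])
      (by rw [R1 1 (by omega), h1])
    have W1 : σ2.reg (2 * k + 1) = e.eval w a := by rw [R2 _ (by omega), V1]
    have W2 : σ2.reg (2 * k + 3) = f.eval w a := V2
    refine ⟨_, _, E1.seq (E2.seq (Exec.arith σ2 o _ _ _)), ?_, M2.trans M1, ?_, ?_⟩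
    · rw [W1, W2]
      exact add_le_pow hB T1 (add_le_pow hB T2
        (add_le_pow hB (bitLen_le_pow hB ve) (bitLen_le_pow hB vf)))
    · simp [State.setReg, W1, W2, Term.eval]
    · intro r hr
      have : r ≠ 2 * k + 1 := by omega
      simp only [State.setReg, Function.update_of_ne this]
      rw [R2 r (by omega), R1 r hr]
  | inp e ihe =>
    obtain ⟨c, hc⟩ := ihe
    refine ⟨c + ((c + 1) + 2 + 1) + 1, fun B w a hB hw ha => ?_⟩
    obtain ⟨ve, He⟩ := hc B w a hB hw ha
    have hwB : ∀ i, w i ≤ B ^ 1 := by simpa using hw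
    refine ⟨(hw _).trans (Nat.le_self_pow (by omega) B), ?_⟩
    intro k σ hk hm h1
    obtain ⟨t, σ1, E1, T1, M1, V1, R1⟩ := He k σ hk hm h1
    refine ⟨_, _, E1.seq (Exec.load σ1 _ _ _), ?_, M1, ?_, ?_⟩
    · rw [V1, M1, hm]
      exact (add_le_pow hB T1 (add_le_pow hB (bitLen_le_pow hB ve)
        (bitLen_le_pow hB (hwB _)))).trans (pow_le_pow_of_two_le hB (by omega))
    · simp [State.setReg, V1, M1, hm, Term.eval]
    · intro r hr
      have : r ≠ 2 * k + 1 := by omega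
      simp only [State.setReg, Function.update_of_ne this]
      rw [R1 r hr]
  | start e ihe =>
    obtain ⟨c, hc⟩ := ihe
    refine ⟨5 * c + 28, fun B w a hB hw ha => ?_⟩
    obtain ⟨ve, He⟩ := hc B w a hB hw ha
    set j := e.eval w a with ej
    have hB1 : B + 1 ≤ B ^ 2 := by nlinarith
    have hXle : 2 + j * (B + 1) ≤ B ^ (1 + (c + 2) + 1) :=
      add_le_pow hB (by simpa using hB) (mul_le_pow ve hB1)
    -- Large enough for every position that the jumps reach, for the contents of a cell, and for the
    -- countdown.
    set X := 2 + j * (B + 1) + (B + 1) + j with eX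
    have hval : (fun q => q + 1 + w q)^[j] 2 ≤ B ^ (1 + (c + 2) + 1) :=
      (iterate_start_le hw j 2).trans hXle
    refine ⟨hval.trans (pow_le_pow_of_two_le hB (by omega)), ?_⟩
    intro k σ hk hm h1
    obtain ⟨t, σ1, E1, T1, M1, V1, R1⟩ := He k σ hk hm h1
    have E2 := Exec.const σ1 (2 * k + 3) 2
    set σ2 := σ1.setReg (2 * k + 3) 2 with e2
    have E3 := Exec.const σ2 (2 * k + 7) 1
    set σ3 := σ2.setReg (2 * k + 7) 1 with e3
    have hX := add_le_pow hB (add_le_pow hB hXle hB1) ve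
    obtain ⟨u, σ4, E4, T4, M4, Z4, V4, R4⟩ := exec_startLoop hw (X := X) (by omega) k j 2 σ3
      (by rw [← hm, ← M1]; rfl) (by simp [e3, e2, State.setReg, V1]) (by simp [e3, e2, State.setReg])
      (by simp [e3, State.setReg]) (by omega) (by omega)
    refine ⟨_, _, E1.seq (E2.seq (E3.seq (E4.seq (Exec.arith σ4 .add _ _ _)))), ?_, M4.trans M1,
      ?_, ?_⟩
    · rw [Z4, V4]
      have b0 : bitLen 0 ≤ B ^ 1 := bitLen_le_pow hB (a := 0) (by simp)
      have b1 : bitLen 1 ≤ B ^ 1 := bitLen_le_pow hB (a := 0) (by simp)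
      have b2 : bitLen 2 ≤ B ^ 2 := bitLen_le_pow hB (a := 1) (by simpa using hB)
      have n9 : 9 ≤ B ^ 4 := le_trans (by norm_num) (Nat.pow_le_pow_left hB 4)
      have hu := T4.trans (mul_le_pow (add_le_pow hB ve (b := 0) (le_refl 1))
        (mul_le_pow n9 (bitLen_le_pow hB hX)))
      exact (add_le_pow hB T1 (add_le_pow hB b2 (add_le_pow hB b1 (add_le_pow hB hu
        (add_le_pow hB b0 (bitLen_le_pow hB hval)))))).trans (pow_le_pow_of_two_le hB (by omega))
    -- The loop leaves `0` in slot `k`, so the final addition copies the position from slot `k + 1`.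
    · simp [State.setReg, Z4, V4, Op.eval, Term.eval, ej]
    · intro r hr
      have : r ≠ 2 * k + 1 ∧ r ≠ 2 * k + 3 ∧ r ≠ 2 * k + 7 := by omega
      simp only [State.setReg, Function.update_of_ne this.1]
      rw [R4 r hr, ← R1 r hr]
      simp [e3, e2, State.setReg, this]

/-! # Writing a table -/

/-- One iteration of `fill`. -/
def fillBody (e : Term) : Prog :=
  .seq (.const 3 1) (.seq (.arith .sub 1 1 3) (.seq (e.compile 1) (.store 1 1 3)))

/-- Write the values of `e` at `0, 1, …` to array `1`, as many as the value of `l` tells. -/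
def fill (l e : Term) : Prog :=
  .seq (l.compile 1) (.seq (.arith .add 1 1 3) (.loop 1 (fillBody e)))

/-- The table is written downwards, so that register `1` serves both as loop counter and as the
variable of the term. Register `3` holds first the decrement `1` and then the computed entry. -/
theorem exec_fillLoop (e : Term) : ∃ c : ℕ, ∀ (B : ℕ) (w : ℕ → ℕ), 2 ≤ B → (∀ i, w i ≤ B) →
    ∀ (n : ℕ) (σ : State), n ≤ B → σ.mem 0 = w → σ.reg 1 = n →
      ∃ t σ', Exec (.loop 1 (fillBody e)) σ t σ' ∧ t ≤ (n + 1) * B ^ c ∧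
        (∀ r, r % 2 = 0 → σ'.reg r = σ.reg r) ∧ (∀ A, A ≠ 1 → σ'.mem A = σ.mem A) ∧
        ∀ i, σ'.mem 1 i = if i < n then e.eval w i else σ.mem 1 i := by
  obtain ⟨c, hc⟩ := e.exec_compile
  refine ⟨2 + (1 + (2 + 1 + 1 + (c + (2 + (c + 1) + 1) + 1) + 1) + 1) + 1, ?_⟩
  intro B w hB hw n
  have b1 : bitLen 1 ≤ B ^ 1 := bitLen_le_pow hB (a := 0) (by simp)
  have bn : ∀ n ≤ B, bitLen n ≤ B ^ 2 := fun n hn => bitLen_le_pow hB (a := 1) (by simpa using hn)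
  induction n with
  | zero =>
    intro σ _ hm h1
    refine ⟨_, σ, Exec.loop_false h1, ?_, fun _ _ => rfl, fun _ _ => rfl, fun i => by simp⟩
    rw [h1, zero_add, one_mul]
    exact (bn 0 (by omega)).trans (pow_le_pow_of_two_le hB (by omega))
  | succ n ih =>
    intro σ hn hm h1
    have E1 := Exec.const σ 3 1
    set σ1 := σ.setReg 3 1 with e1
    have E2 := Exec.arith σ1 .sub 1 1 3
    set σ2 := σ1.setReg 1 (Op.sub.eval (σ1.reg 1) (σ1.reg 3)) with e2
    have a1 : σ1.reg 1 = n + 1 := by simp [e1, State.setReg, h1]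
    have a3 : σ1.reg 3 = 1 := by simp [e1, State.setReg]
    have b1' : σ2.reg 1 = n := by simp [e2, State.setReg, a1, a3, Op.eval]
    obtain ⟨ve, He⟩ := hc B w n hB hw (by omega)
    obtain ⟨t, σ3, E3, T3, M3, V3, R3⟩ := He 1 σ2 le_rfl hm b1'
    have V3' : σ3.reg 3 = e.eval w n := V3
    have R31 : σ3.reg 1 = n := by rw [R3 1 (by omega), b1']
    have E4 := Exec.store σ3 1 1 3
    set σ4 := σ3.setMem 1 (σ3.reg 1) (σ3.reg 3) with e4
    have M4 : ∀ A, A ≠ 1 → σ4.mem A = σ.mem A := by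
      intro A hA
      simp only [e4, State.setMem, Function.update_of_ne hA, M3]
      rfl
    obtain ⟨u, σ5, E5, T5, R5, M5, V5⟩ := ih σ4 (by omega) (by rw [M4 0 (by omega), hm]) R31
    refine ⟨_, σ5, Exec.loop_true (by omega) (E1.seq (E2.seq (E3.seq E4))) E5, ?_, ?_, ?_, ?_⟩
    · rw [h1, a1, a3, R31, V3']
      have h := add_le_pow hB (bn (n + 1) hn) (add_le_pow hB b1 (add_le_pow hB
        (add_le_pow hB (bn (n + 1) hn) b1) (add_le_pow hB T3 (add_le_pow hB (bn n (by omega))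
        (bitLen_le_pow hB ve)))))
      rw [Nat.succ_mul (n + 1)]
      omega
    · intro r hr
      have hne : r ≠ 1 ∧ r ≠ 3 := by omega
      rw [R5 r hr]
      change σ3.reg r = _
      rw [R3 r (by omega)]
      simp [e2, e1, State.setReg, hne]
    · intro A hA
      rw [M5 A hA, M4 A hA]
    · intro i
      rw [V5 i]
      have hM : σ3.mem 1 = σ.mem 1 := by rw [M3]; rfl
      by_cases hi : i < n
      · simp [hi, Nat.lt_succ_of_lt hi]
      · by_cases hi' : i = n
        · subst hi'
          simp [e4, State.setMem, R31, V3']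
        · have : ¬ i < n + 1 := by omega
          simp [hi, this, e4, State.setMem, R31, hi', hM]

theorem exec_fill (l e : Term) : ∃ c : ℕ, ∀ (B : ℕ) (w : List ℕ), 2 ≤ B → (∀ x ∈ w, x ≤ B) →
    l.eval (fun i => w.getD i 0) 0 ≤ B ^ c ∧
    (∀ a, a < l.eval (fun i => w.getD i 0) 0 → e.eval (fun i => w.getD i 0) a ≤ B ^ c) ∧
    ∃ t σ, Exec (fill l e) (State.init w) t σ ∧ t ≤ B ^ c ∧ (∀ r, r % 2 = 0 → σ.reg r = 0) ∧
      (∀ A, 2 ≤ A → ∀ i, σ.mem A i = 0) ∧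
      ∀ i, σ.mem 1 i = if i < l.eval (fun i => w.getD i 0) 0
        then e.eval (fun i => w.getD i 0) i else 0 := by
  obtain ⟨a, ha⟩ := l.exec_compile
  obtain ⟨b, hb⟩ := exec_fillLoop e
  obtain ⟨d, hd⟩ := e.exec_compile
  refine ⟨a + (a + 1 + 1 + 1 + (a + 1 + 0 + (a + 1) * b) + 1) + 1 + (a + 1) * d, ?_⟩
  intro B w hB hw
  have hw' : ∀ i, w.getD i 0 ≤ B := by
    intro i
    rcases lt_or_ge i w.length with h | h
    · rw [List.getD_eq_getElem _ _ h]
      exact hw _ (List.getElem_mem h)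
    · rw [List.getD_eq_default _ _ h]
      omega
  set f : ℕ → ℕ := fun i => w.getD i 0 with ef
  obtain ⟨vl, Hl⟩ := ha B f 0 hB hw' (by omega)
  have hB' : B ≤ B ^ (a + 1) := Nat.le_self_pow (by omega) B
  have hlB : l.eval f 0 ≤ B ^ (a + 1) := vl.trans (pow_le_pow_of_two_le hB (by omega))
  have hw'' : ∀ i, f i ≤ B ^ (a + 1) := fun i => (hw' i).trans hB'
  refine ⟨vl.trans (pow_le_pow_of_two_le hB (by omega)), ?_, ?_⟩
  · intro x hx
    have := (hd (B ^ (a + 1)) f x (hB.trans hB') hw'' (by omega)).1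
    rw [← pow_mul] at this
    exact this.trans (pow_le_pow_of_two_le hB (by omega))
  obtain ⟨t, σ1, E1, T1, M1, V1, R1⟩ := Hl 1 (State.init w) le_rfl (by simp [State.init, ef]) rfl
  have V1' : σ1.reg 3 = l.eval f 0 := V1
  have R11 : σ1.reg 1 = 0 := R1 1 (by omega)
  have E2 := Exec.arith σ1 .add 1 1 3
  set σ2 := σ1.setReg 1 (Op.add.eval (σ1.reg 1) (σ1.reg 3)) with e2
  obtain ⟨u, σ3, E3, T3, R3, M3, V3⟩ := hb (B ^ (a + 1)) f (hB.trans hB') hw'' (l.eval f 0) σ2 hlB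
    (by simp [e2, State.setReg, M1, State.init, ef])
    (by simp [e2, State.setReg, R11, V1', Op.eval])
  refine ⟨_, σ3, E1.seq (E2.seq E3), ?_, ?_, ?_, ?_⟩
  · rw [R11, V1']
    rw [← pow_mul] at T3
    have b0 : bitLen 0 ≤ B ^ 1 := bitLen_le_pow hB (a := 0) (by simp)
    have h1 := T3.trans (mul_le_pow (add_le_pow hB vl (b := 0) (le_refl 1)) (le_refl _))
    exact (add_le_pow hB T1 (add_le_pow hB (add_le_pow hB b0 (bitLen_le_pow hB vl)) h1)).trans
      (pow_le_pow_of_two_le hB (by omega))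
  · intro r hr
    have : r ≠ 1 := by omega
    rw [R3 r hr]
    simp only [e2, State.setReg, Function.update_of_ne this]
    rw [R1 r (by omega)]
    rfl
  · intro A hA i
    rw [M3 A (by omega)]
    change σ1.mem A i = 0
    rw [M1]
    simp [State.init, show A ≠ 0 by omega]
  · intro i
    rw [V3 i]
    congr 1
    change σ1.mem 1 i = 0
    rw [M1]
    simp [State.init]

/-! # Moving a program to other registers and arrays -/

/-- The program that uses register `2 * r` instead of `r` and array `A + 1` instead of `A`. -/
def Prog.shift : Prog → Prog
  | .const r c => .const (2 * r) c
  | .arith o r a b => .arith o (2 * r) (2 * a) (2 * b)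
  | .load r A a => .load (2 * r) (A + 1) (2 * a)
  | .store A a b => .store (A + 1) (2 * a) (2 * b)
  | .seq p q => .seq p.shift q.shift
  | .ite r p q => .ite (2 * r) p.shift q.shift
  | .loop r p => .loop (2 * r) p.shift

/-- The even registers of `σ` are the registers of `s`, and the arrays of `σ` other than array `0`
are the arrays of `s`. -/
def State.Extends (σ s : State) : Prop :=
  (∀ r, σ.reg (2 * r) = s.reg r) ∧ ∀ A, σ.mem (A + 1) = s.mem A

theorem State.Extends.setReg {σ s : State} (h : σ.Extends s) (r x : ℕ) :
    (σ.setReg (2 * r) x).Extends (s.setReg r x) := by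
  refine ⟨fun r' => ?_, h.2⟩
  by_cases hr : r' = r
  · simp [State.setReg, hr]
  · simp [State.setReg, hr, h.1 r']

theorem State.Extends.setMem {σ s : State} (h : σ.Extends s) (A i x : ℕ) :
    (σ.setMem (A + 1) i x).Extends (s.setMem A i x) := by
  refine ⟨h.1, fun A' => ?_⟩
  by_cases hA : A' = A
  · simp [State.setMem, hA, h.2 A]
  · simp [State.setMem, hA, h.2 A']

/-- The moved program handles the same numbers, so even the cost is unchanged. Whatever the
evaluation of terms left in the odd registers, and the original input in array `0`, are invisible to
it. -/
theorem Exec.shift {p : Prog} {s s' : State} {t : ℕ} (h : Exec p s t s') :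
    ∀ {σ : State}, σ.Extends s → ∃ σ', Exec p.shift σ t σ' ∧ σ'.Extends s' := by
  induction h with
  | const s r c => exact fun {σ} hσ => ⟨_, Exec.const σ (2 * r) c, hσ.setReg r c⟩
  | arith s o r a b =>
    intro σ hσ
    have := Exec.arith σ o (2 * r) (2 * a) (2 * b)
    rw [hσ.1 a, hσ.1 b] at this
    exact ⟨_, this, hσ.setReg r _⟩
  | load s r A a =>
    intro σ hσ
    have := Exec.load σ (2 * r) (A + 1) (2 * a)
    rw [hσ.1 a, hσ.2 A] at this
    exact ⟨_, this, hσ.setReg r _⟩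
  | store s A a b =>
    intro σ hσ
    have := Exec.store σ (A + 1) (2 * a) (2 * b)
    rw [hσ.1 a, hσ.1 b] at this
    exact ⟨_, this, hσ.setMem A _ _⟩
  | seq _ _ ih₁ ih₂ =>
    intro σ hσ
    obtain ⟨σ₁, E₁, h₁⟩ := ih₁ hσ
    obtain ⟨σ₂, E₂, h₂⟩ := ih₂ h₁
    exact ⟨σ₂, E₁.seq E₂, h₂⟩
  | @ite_true r _ _ _ _ _ hr _ ih =>
    intro σ hσ
    obtain ⟨σ₁, E₁, h₁⟩ := ih hσ
    rw [← hσ.1 r] at hr ⊢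
    exact ⟨σ₁, Exec.ite_true hr E₁, h₁⟩
  | @ite_false r _ _ _ _ _ hr _ ih =>
    intro σ hσ
    obtain ⟨σ₁, E₁, h₁⟩ := ih hσ
    rw [← hσ.1 r] at hr ⊢
    exact ⟨σ₁, Exec.ite_false hr E₁, h₁⟩
  | @loop_true r _ _ _ _ _ _ hr _ _ ih₁ ih₂ =>
    intro σ hσ
    obtain ⟨σ₁, E₁, h₁⟩ := ih₁ hσ
    obtain ⟨σ₂, E₂, h₂⟩ := ih₂ h₁
    rw [← hσ.1 r] at hr ⊢
    exact ⟨σ₂, Exec.loop_true hr E₁ E₂, h₂⟩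
  | @loop_false r _ _ hr =>
    intro σ hσ
    rw [← hσ.1 r] at hr ⊢
    exact ⟨σ, Exec.loop_false hr, hσ⟩

theorem Exec.one_le {p : Prog} {s s' : State} {t : ℕ} (h : Exec p s t s') : 1 ≤ t := by
  induction h with
  | const s r c => exact one_le_bitLen c
  | arith => exact (one_le_bitLen _).trans (Nat.le_add_right _ _)
  | load => exact (one_le_bitLen _).trans (Nat.le_add_right _ _)
  | store => exact (one_le_bitLen _).trans (Nat.le_add_right _ _)
  | loop_false => exact one_le_bitLen _
  | _ => omega

end RAM

/-! # Polynomial-time reductions -/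

/-- If the instances of `P` are mapped to instances of `Q` by evaluating a term at `0, 1, …`, then
an algorithm for `Q` gives one for `P`, up to a factor that is polynomial in the largest number of
the input. -/
theorem ParamProblem.SolvableInOStar.of_fill {P Q : ParamProblem} {b : ℝ} (hb : 0 ≤ b)
    (hQ : Q.SolvableInOStar b) (f : P.Inst → Q.Inst) (l e : RAM.Term)
    (hf : ∀ x, Q.encode (f x) =
      (List.range (l.eval (fun i => (P.encode x).getD i 0) 0)).map
        fun a => e.eval (fun i => (P.encode x).getD i 0) a)
    (hyes : ∀ x, Q.IsYes (f x) ↔ P.IsYes x) (hone : ∀ x, 1 ≤ b ^ Q.param (f x)) :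
    ∃ (p : RAM.Prog) (C c : ℕ), ∀ (x : P.Inst) (B : ℕ), 2 ≤ B → (∀ y ∈ P.encode x, y ≤ B) →
      ∃ (t : ℕ) (s : RAM.State), RAM.Exec p (RAM.State.init (P.encode x)) t s ∧
        (s.reg 0 ≠ 0 ↔ P.IsYes x) ∧ (t : ℝ) ≤ (C : ℝ) * (B : ℝ) ^ c * b ^ Q.param (f x) := by
  obtain ⟨q, C, c, hq⟩ := hQ
  obtain ⟨d, hd⟩ := RAM.exec_fill l e
  -- Filling the table costs at most `B ^ d`. The table has at most `B ^ d` entries of at most `B ^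
  -- (d + 1)` bits each, and this size is raised to the power `c` by the algorithm for `Q`.
  refine ⟨.seq (RAM.fill l e) q.shift, C + 1, d + (d + (d + 1)) * c, fun x B hB hx => ?_⟩
  obtain ⟨hl, he, t₁, σ₁, E₁, T₁, R₁, M₁, V₁⟩ := hd B (P.encode x) hB hx
  obtain ⟨t₂, s₂, E₂, hs₂, T₂⟩ := hq (f x)
  have hext : σ₁.Extends (RAM.State.init (Q.encode (f x))) := by
    refine ⟨fun r => R₁ _ (by omega), fun A => funext fun i => ?_⟩
    by_cases hA : A = 0
    · subst hA
      rw [V₁ i, hf x]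
      generalize (fun i => (P.encode x).getD i 0) = w
      by_cases hi : i < l.eval w 0
      · simp [RAM.State.init, hi]
      · simp [RAM.State.init, hi]
    · rw [M₁ _ (by omega)]
      simp [RAM.State.init, hA]
  obtain ⟨σ₂, E₃, h₃⟩ := E₂.shift hext
  refine ⟨_, σ₂, E₁.seq E₃, ?_, ?_⟩
  · rw [← hyes x, ← hs₂, ← h₃.1 0]
  have hsize : Q.size (f x) ≤ B ^ (d + (d + 1)) := by
    unfold ParamProblem.size
    rw [hf x, List.map_map]
    refine (List.sum_le_card_nsmul _ (B ^ (d + 1)) ?_).trans ?_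
    · intro y hy
      simp only [List.mem_map, List.mem_range, Function.comp] at hy
      obtain ⟨a, ha, rfl⟩ := hy
      exact RAM.bitLen_le_pow hB (he a ha)
    · simp only [List.length_map, List.length_range, smul_eq_mul]
      exact RAM.mul_le_pow hl le_rfl
  have hB1 : (1 : ℝ) ≤ B := by exact_mod_cast (by omega : 1 ≤ B)
  have T₁' : (t₁ : ℝ) ≤ (B : ℝ) ^ (d + (d + (d + 1)) * c) * b ^ Q.param (f x) := by
    have h1 : (t₁ : ℝ) ≤ (B : ℝ) ^ d := by exact_mod_cast T₁
    have h2 : (B : ℝ) ^ d ≤ (B : ℝ) ^ (d + (d + (d + 1)) * c) := pow_le_pow_right₀ hB1 (by omega)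
    exact (h1.trans h2).trans (le_mul_of_one_le_right (by positivity) (hone x))
  have T₂' : (t₂ : ℝ) ≤ C * (B : ℝ) ^ (d + (d + (d + 1)) * c) * b ^ Q.param (f x) := by
    refine T₂.trans ?_
    have h1 : ((Q.size (f x) : ℝ)) ^ c ≤ (B : ℝ) ^ (d + (d + (d + 1)) * c) := by
      have : (Q.size (f x) : ℝ) ≤ (B : ℝ) ^ (d + (d + 1)) := by exact_mod_cast hsize
      calc ((Q.size (f x) : ℝ)) ^ c ≤ ((B : ℝ) ^ (d + (d + 1))) ^ c := by gcongr
        _ = (B : ℝ) ^ ((d + (d + 1)) * c) := by rw [← pow_mul]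
        _ ≤ _ := pow_le_pow_right₀ hB1 (by omega)
    gcongr
  push_cast
  linarith

/-! # Dominating sets and packings -/

namespace SimpleGraph

variable {V : Type*} {G : SimpleGraph V}

theorem forall_of_connected_induce {S : Set V} (hS : (G.induce S).Connected) {P : V → Prop}
    {u : V} (hu : u ∈ S) (hP : P u) (h : ∀ x ∈ S, ∀ y ∈ S, P x → G.Adj x y → P y) :
    ∀ x ∈ S, P x := by
  intro x hx
  obtain ⟨walk⟩ := hS.preconnected ⟨u, hu⟩ ⟨x, hx⟩
  have key : ∀ (a b : S), (G.induce S).Walk a b → P a → P b := by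
    intro a b walk
    induction walk with
    | nil => exact id
    | cons hadj _ ih => exact fun ha => ih (h _ (Subtype.mem _) _ (Subtype.mem _) ha hadj)
  exact key _ _ walk hP

/-- Connectivity turns domination into total domination: a member of `S` without a neighbor in `S`
would be a component of its own. The packing argument needs this because the centers of the
neighborhoods may themselves lie in `S`. -/
theorem IsConnectedDominatingSet.exists_adj {S : Set V} (hS : G.IsConnectedDominatingSet S)
    (hS' : S.Nontrivial) (v : V) : ∃ u ∈ S, G.Adj v u := by
  by_cases hv : v ∈ S
  · by_contra! hne
    obtain ⟨x, hx, hxv⟩ := hS'.exists_ne v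
    refine hxv (forall_of_connected_induce hS.2 (P := fun x => x = v) hv rfl ?_ x hx)
    rintro _ _ y hy rfl hadj
    exact absurd hadj (hne y hy)
  · exact hS.1 v hv

/-- If a set hits pairwise disjoint neighborhoods and has at most as many elements as there are
neighborhoods, then it contains only one element of each of them. -/
theorem eq_of_adj_of_card_le {ι : Type*} [Fintype ι] {S : Finset V} (w : ι → V)
    (hw : ∀ u i i', G.Adj (w i) u → G.Adj (w i') u → i = i')
    (hS : ∀ i, ∃ u ∈ S, G.Adj (w i) u) (hcard : S.card ≤ Fintype.card ι)
    {i : ι} {u u' : V} (hu : u ∈ S) (hu' : u' ∈ S) (h : G.Adj (w i) u) (h' : G.Adj (w i) u') :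
    u = u' := by
  classical
  choose f hf hf' using hS
  have hinj : Function.Injective f := fun i i' hii' => hw (f i) i i' (hf' i) (hii' ▸ hf' i')
  have himage : Finset.univ.image f = S := by
    refine Finset.eq_of_subset_of_card_le (fun x hx => ?_) ?_
    · obtain ⟨i, -, rfl⟩ := Finset.mem_image.mp hx
      exact hf i
    · rwa [Finset.card_image_of_injective _ hinj, Finset.card_univ]
  have key : ∀ u ∈ S, G.Adj (w i) u → u = f i := by
    intro u hu h
    rw [← himage] at hu
    obtain ⟨i', -, rfl⟩ := Finset.mem_image.mp hu
    rw [hw _ _ _ h (hf' i')]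
  rw [key u hu h, key u' hu' h']

end SimpleGraph

/-! # The graph -/

/-- Rows that run through the columns `0, …, M`, and selectors that check the states of rows.

Every column has a block of vertices for each of the `R` rows, for each of the `D` selectors, and
one for a clause. Selector `x` takes part in column `j` if `act j x`; then it is connected to the
`p` rows from `base j x` on, and it checks that row `base j x + r` has state `dig x r`. -/
structure Layout where
  R : ℕ
  p : ℕ
  D : ℕ
  M : ℕ
  act : ℕ → ℕ → Prop
  base : ℕ → ℕ → ℕ
  dig : ℕ → ℕ → ℕ

namespace Layout

variable (L : Layout)

/-- The number of blocks of a column. -/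
def W : ℕ := L.R + L.D + 1

/-- The number of vertices of a block. -/
def K : ℕ := 8 + 2 * L.p

/-- The number of vertices. -/
def N : ℕ := (L.M + 1) * L.W * L.K

/-- The number of vertices of a smallest connected dominating set, if the selectors can be chosen
consistently. -/
def budget : ℕ := (L.M + 1) * (L.W + L.D) + 2 * (L.M * L.R)

/-- The vertex `t` of block `i` in column `j` is not a neighbor of the root of its block (which is
its vertex `0`). -/
def Inner (j i t : ℕ) : Prop :=
  (i < L.R ∧ (t = 3 ∧ 0 < j ∨ t = 5 ∧ j < L.M ∨ (t = 6 ∨ t = 7) ∧ 0 < j ∧ j < L.M)) ∨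
  (L.R ≤ i ∧ i < L.R + L.D ∧ (t = 2 ∨ L.act j (i - L.R) ∧
    (8 ≤ t ∧ t < 8 + L.p ∧ L.dig (i - L.R) (t - 8) ≠ 0 ∨
      8 + L.p ≤ t ∧ L.dig (i - L.R) (t - (8 + L.p)) ≠ 2))) ∨
  (i = L.R + L.D ∧ t = 2 ∧ 0 < j ∧ j < L.M)

/-- The edges of a row: the vertices `2`, `3` and `4`, `5` of a block carry the state of the row
left and right of the column; the vertices `6` and `7` compare these states. -/
def RowEdge (j i t j' i' t' : ℕ) : Prop :=
  i < L.R ∧ i' = i ∧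
    (j' = j ∧ (t = 2 ∧ t' = 3 ∨ t = 4 ∧ t' = 5 ∨ t = 6 ∧ (t' = 2 ∨ t' = 5) ∨
      t = 7 ∧ (t' = 3 ∨ t' = 4)) ∨ j' = j + 1 ∧ t = 5 ∧ t' = 3)

/-- The edges inside of a selector: vertex `2` forces vertex `3` (selected) or `4` (not selected)
into the dominating set; vertex `4` dominates the check vertices `8, 9, …`. -/
def SelectorEdge (j i t j' i' t' : ℕ) : Prop :=
  L.R ≤ i ∧ i < L.R + L.D ∧ i' = i ∧ j' = j ∧ (t = 2 ∧ (t' = 3 ∨ t' = 4) ∨ t = 4 ∧ 8 ≤ t')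

/-- The edges between an active selector and the clause vertex, and between its check vertices and
the rows. -/
def CheckEdge (j i t j' i' t' : ℕ) : Prop :=
  L.R ≤ i ∧ i < L.R + L.D ∧ j' = j ∧ L.act j (i - L.R) ∧
    (t = 3 ∧ i' = L.R + L.D ∧ t' = 2 ∨
      8 ≤ t ∧ t < 8 + L.p ∧ i' = L.base j (i - L.R) + (t - 8) ∧
        (L.dig (i - L.R) (t - 8) = 1 ∧ t' = 4 ∨ L.dig (i - L.R) (t - 8) = 2 ∧ t' = 5) ∨
      8 + L.p ≤ t ∧ i' = L.base j (i - L.R) + (t - (8 + L.p)) ∧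
        (L.dig (i - L.R) (t - (8 + L.p)) = 1 ∧ t' = 2 ∨
          L.dig (i - L.R) (t - (8 + L.p)) = 0 ∧ t' = 3))

/-- The edges, each in one direction, between vertices that are given by column, block, and number
in the block. -/
def Edge (j i t j' i' t' : ℕ) : Prop :=
  (t = 0 ∧ t' = 0 ∧ (j' = j ∧ i' = i + 1 ∨ j' = j + 1 ∧ i' = 0 ∧ i + 1 = L.W)) ∨
  (j' = j ∧ i' = i ∧ t = 0 ∧ t' ≠ 0 ∧ ¬ L.Inner j i t') ∨
  L.RowEdge j i t j' i' t' ∨ L.SelectorEdge j i t j' i' t' ∨ L.CheckEdge j i t j' i' t'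

/-- The column of a vertex. -/
def col (u : ℕ) : ℕ := u / L.K / L.W

/-- The block of a vertex. -/
def blk (u : ℕ) : ℕ := u / L.K % L.W

/-- The number of a vertex in its block. -/
def typ (u : ℕ) : ℕ := u % L.K

/-- The graph of a layout. -/
def graph : SimpleGraph (Fin L.N) :=
  SimpleGraph.fromRel fun u v =>
    L.Edge (L.col u) (L.blk u) (L.typ u) (L.col v) (L.blk v) (L.typ v)

theorem W_pos : 0 < L.W := Nat.succ_pos _

theorem K_pos : 0 < L.K := by unfold K; omega

theorem col_le (u : Fin L.N) : L.col u ≤ L.M := by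
  have h : (u : ℕ) < (L.M + 1) * L.W * L.K := u.2
  exact Nat.lt_succ_iff.mp ((Nat.div_lt_iff_lt_mul L.W_pos).mpr
    ((Nat.div_lt_iff_lt_mul L.K_pos).mpr h))

theorem blk_lt (u : ℕ) : L.blk u < L.W := Nat.mod_lt _ L.W_pos

theorem typ_lt (u : ℕ) : L.typ u < L.K := Nat.mod_lt _ L.K_pos

theorem eq_of_coords {u v : ℕ} (h₁ : L.col u = L.col v) (h₂ : L.blk u = L.blk v)
    (h₃ : L.typ u = L.typ v) : u = v := by
  have h : u / L.K = v / L.K := by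
    rw [← Nat.div_add_mod (u / L.K) L.W, ← Nat.div_add_mod (v / L.K) L.W]
    unfold col at h₁
    unfold blk at h₂
    rw [h₁, h₂]
  rw [← Nat.div_add_mod u L.K, ← Nat.div_add_mod v L.K, h]
  unfold typ at h₃
  rw [h₃]

/-- The vertex with given coordinates. -/
def vertex (j i t : ℕ) (hj : j ≤ L.M) (hi : i < L.W) (ht : t < L.K) : Fin L.N :=
  ⟨(j * L.W + i) * L.K + t, by
    have h₁ : (j + 1) * L.W ≤ (L.M + 1) * L.W := Nat.mul_le_mul_right _ (by omega)
    have h₂ : (j * L.W + i + 1) * L.K ≤ (L.M + 1) * L.W * L.K := by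
      rw [Nat.succ_mul] at h₁
      exact Nat.mul_le_mul_right _ (by omega)
    rw [Nat.succ_mul] at h₂
    unfold N
    omega⟩

section vertex

variable {L} {j i t : ℕ} (hj : j ≤ L.M) (hi : i < L.W) (ht : t < L.K)

theorem vertex_div : (L.vertex j i t hj hi ht : ℕ) / L.K = j * L.W + i := by
  simp only [vertex]
  rw [mul_comm, Nat.mul_add_div L.K_pos, Nat.div_eq_of_lt ht, add_zero]

@[simp] theorem col_vertex : L.col (L.vertex j i t hj hi ht) = j := by
  rw [col, vertex_div, mul_comm, Nat.mul_add_div L.W_pos, Nat.div_eq_of_lt hi, add_zero]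

@[simp] theorem blk_vertex : L.blk (L.vertex j i t hj hi ht) = i := by
  rw [blk, vertex_div, mul_comm, Nat.mul_add_mod, Nat.mod_eq_of_lt hi]

@[simp] theorem typ_vertex : L.typ (L.vertex j i t hj hi ht) = t := by
  simp only [typ, vertex]
  rw [mul_comm, Nat.mul_add_mod, Nat.mod_eq_of_lt ht]

end vertex

theorem Edge.irrefl {j i t : ℕ} : ¬ L.Edge j i t j i t := by
  unfold Edge RowEdge SelectorEdge CheckEdge
  omega

theorem adj_iff (u v : Fin L.N) : L.graph.Adj u v ↔
    L.Edge (L.col u) (L.blk u) (L.typ u) (L.col v) (L.blk v) (L.typ v) ∨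
    L.Edge (L.col v) (L.blk v) (L.typ v) (L.col u) (L.blk u) (L.typ u) := by
  rw [graph, SimpleGraph.fromRel_adj]
  refine ⟨fun h => h.2, fun h => ⟨?_, h⟩⟩
  rintro rfl
  exact Edge.irrefl L (h.elim id id)

/-- The vertices whose neighborhoods are pairwise disjoint. -/
def Pack (j i t : ℕ) : Prop :=
  t = 1 ∨ (i < L.R ∧ (t = 5 ∧ j < L.M ∨ t = 3 ∧ 0 < j)) ∨ (L.R ≤ i ∧ i < L.R + L.D ∧ t = 2)

/-- The coordinates of the only possible neighbor that satisfies `Pack`. -/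
def lab (j i t : ℕ) : ℕ × ℕ × ℕ :=
  if t = 0 then (j, i, 1)
  else if i < L.R then
    if t = 3 then (j - 1, i, 5)
    else if t = 4 ∨ t = 6 then (j, i, 5)
    else if t = 5 then (j + 1, i, 3)
    else (j, i, 3)
  else if t = 3 ∨ t = 4 then (j, i, 2)
  else if t < 8 + L.p then (j, L.base j (i - L.R) + (t - 8), 5)
  else (j, L.base j (i - L.R) + (t - (8 + L.p)), 3)

/-- This is the disjointness of the packed neighborhoods. A check vertex sees a single row vertex:
the first `p` of them see only `4` or `5`, the others only `2` or `3`, so one label suffices. The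
bound on `base` keeps check edges away from vertex `2` of a selector. -/
theorem lab_eq_of_edge (hbase : ∀ j x r, L.act j x → r < L.p → L.base j x + r < L.R)
    {j i t j' i' t' : ℕ} (ht' : t' < L.K) (h : L.Pack j i t)
    (hE : L.Edge j i t j' i' t' ∨ L.Edge j' i' t' j i t) : L.lab j' i' t' = (j, i, t) := by
  unfold Edge RowEdge SelectorEdge CheckEdge Inner at hE
  unfold K at ht'
  unfold lab
  rcases h with rfl | ⟨hR, ⟨rfl, hj⟩ | ⟨rfl, hj⟩⟩ | ⟨hR, hD, rfl⟩ <;>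
    rcases hE with (hE | hE | hE | hE | ⟨h1, h2, h3, h4, hE | hE | hE⟩) |
      (hE | hE | hE | hE | ⟨h1, h2, h3, h4, hE | hE | hE⟩) <;>
    first
    | omega
    | (have hb := hbase j (i' - L.R) (t' - (8 + L.p))
       grind)

end Layout

/-! ### From connected dominating sets within the budget to row states -/

namespace Layout

variable (L : Layout)

/-- The vertices that satisfy `Pack`: in every block vertex `1`, for all but the last columns and
every row vertex `5`, for all but the first column and every row vertex `3`, and for every selector
vertex `2`. -/
abbrev Index : Type :=
  (Fin (L.M + 1) × Fin L.W) ⊕ (Fin L.M × Fin L.R) ⊕ (Fin L.M × Fin L.R) ⊕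
    (Fin (L.M + 1) × Fin L.D)

theorem card_index : Fintype.card L.Index = L.budget := by
  simp only [Index, Fintype.card_sum, Fintype.card_prod, Fintype.card_fin, budget]
  ring

theorem lt_W_of_lt_R {i : ℕ} (h : i < L.R) : i < L.W := by unfold W; omega

theorem add_lt_W {x : ℕ} (h : x < L.D) : L.R + x < L.W := by unfold W; omega

theorem lt_K {t : ℕ} (h : t < 8 + 2 * L.p) : t < L.K := h

/-- The coordinates of the vertices that satisfy `Pack`. -/
def packCoords : L.Index → ℕ × ℕ × ℕ
  | .inl (j, i) => (j, i, 1)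
  | .inr (.inl (j, r)) => (j, r, 5)
  | .inr (.inr (.inl (j, r))) => (j + 1, r, 3)
  | .inr (.inr (.inr (j, x))) => (j, L.R + x, 2)

theorem packCoords_injective : Function.Injective L.packCoords := by
  rintro (⟨j, i⟩ | ⟨j, i⟩ | ⟨j, i⟩ | ⟨j, i⟩) (⟨j', i'⟩ | ⟨j', i'⟩ | ⟨j', i'⟩ | ⟨j', i'⟩) h <;>
    simp [packCoords, Fin.ext_iff] at h ⊢ <;> omega

theorem packCoords_spec (q : L.Index) : L.Pack (L.packCoords q).1 (L.packCoords q).2.1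
      (L.packCoords q).2.2 ∧
    (L.packCoords q).1 ≤ L.M ∧ (L.packCoords q).2.1 < L.W ∧ (L.packCoords q).2.2 < L.K := by
  rcases q with ⟨j, i⟩ | ⟨j, i⟩ | ⟨j, i⟩ | ⟨j, i⟩ <;>
    have hi := i.2 <;> have hj := j.2 <;> simp only [packCoords] <;> unfold Pack W K
  · unfold W at hi
    exact ⟨Or.inl rfl, by omega, hi, by omega⟩
  · exact ⟨Or.inr (Or.inl ⟨hi, Or.inl ⟨rfl, hj⟩⟩), by omega, by omega, by omega⟩
  · exact ⟨Or.inr (Or.inl ⟨hi, Or.inr ⟨rfl, by omega⟩⟩), by omega, by omega, by omega⟩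
  · exact ⟨Or.inr (Or.inr ⟨by omega, by omega, rfl⟩), by omega, by omega, by omega⟩

theorem exists_packCoords {j i t : ℕ} (hj : j ≤ L.M) (hi : i < L.W) (h : L.Pack j i t) :
    ∃ q, L.packCoords q = (j, i, t) := by
  rcases h with rfl | ⟨hR, ⟨rfl, hj'⟩ | ⟨rfl, hj'⟩⟩ | ⟨hR, hD, rfl⟩
  · exact ⟨.inl (⟨j, by omega⟩, ⟨i, hi⟩), rfl⟩
  · exact ⟨.inr (.inl (⟨j, hj'⟩, ⟨i, hR⟩)), rfl⟩
  · exact ⟨.inr (.inr (.inl (⟨j - 1, by omega⟩, ⟨i, hR⟩))), by simp [packCoords]; omega⟩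
  · exact ⟨.inr (.inr (.inr (⟨j, by omega⟩, ⟨i - L.R, by omega⟩))), by simp [packCoords]; omega⟩

/-- The vertex with given coordinates lies in `S`. -/
def In (S : Finset (Fin L.N)) (j i t : ℕ) : Prop :=
  ∃ u ∈ S, L.col u = j ∧ L.blk u = i ∧ L.typ u = t

/-- A pendant vertex can only be dominated from its own column, and there are at least two columns.
-/
theorem nontrivial_of_dominating (hM : 1 ≤ L.M) {S : Finset (Fin L.N)}
    (hS : L.graph.IsConnectedDominatingSet (S : Set (Fin L.N))) :
    (S : Set (Fin L.N)).Nontrivial := by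
  have key : ∀ j ≤ L.M, ∃ u ∈ S, L.col u = j := by
    intro j hj
    have hK : 1 < L.K := by unfold K; omega
    by_cases hv : L.vertex j 0 1 hj L.W_pos hK ∈ S
    · exact ⟨_, hv, col_vertex ..⟩
    · obtain ⟨u, hu, hadj⟩ := hS.1 _ (by simpa using hv)
      refine ⟨u, by simpa using hu, ?_⟩
      rw [adj_iff] at hadj
      simp only [col_vertex, blk_vertex, typ_vertex] at hadj
      unfold Edge RowEdge SelectorEdge CheckEdge at hadj
      omega
  obtain ⟨u, hu, hu'⟩ := key 0 (by omega)
  obtain ⟨v, hv, hv'⟩ := key 1 hM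
  refine ⟨u, by simpa using hu, v, by simpa using hv, ?_⟩
  rintro rfl
  omega

/-- A connected dominating set within the budget assigns to every row a state in every column that
does not decrease, and in every column some active selector agrees with the states. -/
theorem exists_states (hM : 1 ≤ L.M)
    (hbase : ∀ j x r, L.act j x → r < L.p → L.base j x + r < L.R) (hdig : ∀ x r, L.dig x r ≤ 2)
    {S : Finset (Fin L.N)} (hS : L.graph.IsConnectedDominatingSet (S : Set (Fin L.N)))
    (hcard : S.card ≤ L.budget) :
    ∃ c : ℕ → ℕ → ℕ, (∀ j r, c j r ≤ 2) ∧
      (∀ j r, j + 1 < L.M → r < L.R → c j r ≤ c (j + 1) r) ∧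
      ∀ j, j + 1 < L.M → ∃ x < L.D, L.act (j + 1) x ∧ ∀ r < L.p,
        c j (L.base (j + 1) x + r) ≤ L.dig x r ∧ L.dig x r ≤ c (j + 1) (L.base (j + 1) x + r) := by
  classical
  have hnt := L.nontrivial_of_dominating hM hS
  have dom : ∀ j i t, j ≤ L.M → i < L.W → t < L.K → ∃ j' i' t', L.In S j' i' t' ∧
      t' < L.K ∧ (L.Edge j i t j' i' t' ∨ L.Edge j' i' t' j i t) := by
    intro j i t hj hi ht
    obtain ⟨u, hu, hadj⟩ := hS.exists_adj hnt (L.vertex j i t hj hi ht)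
    rw [adj_iff] at hadj
    simp only [col_vertex, blk_vertex, typ_vertex] at hadj
    exact ⟨_, _, _, ⟨u, by simpa using hu, rfl, rfl, rfl⟩, L.typ_lt u, hadj⟩
  -- Tightness of the packing: with as many chosen vertices as disjoint neighborhoods, no
  -- neighborhood contains two of them.
  have uniq : ∀ j i t, j ≤ L.M → i < L.W → L.Pack j i t → ∀ j₁ i₁ t₁ j₂ i₂ t₂,
      L.In S j₁ i₁ t₁ → L.In S j₂ i₂ t₂ →
      (L.Edge j i t j₁ i₁ t₁ ∨ L.Edge j₁ i₁ t₁ j i t) →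
      (L.Edge j i t j₂ i₂ t₂ ∨ L.Edge j₂ i₂ t₂ j i t) → j₁ = j₂ ∧ i₁ = i₂ ∧ t₁ = t₂ := by
    rintro j i t hj hi hP _ _ _ _ _ _ ⟨u, hu, rfl, rfl, rfl⟩ ⟨v, hv, rfl, rfl, rfl⟩ h₁ h₂
    have hspec := L.packCoords_spec
    let w : L.Index → Fin L.N := fun q =>
      L.vertex _ _ _ (hspec q).2.1 (hspec q).2.2.1 (hspec q).2.2.2
    have hw : ∀ u q, L.graph.Adj (w q) u →
        L.lab (L.col u) (L.blk u) (L.typ u) = L.packCoords q := by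
      intro u q h
      rw [adj_iff] at h
      simp only [w, col_vertex, blk_vertex, typ_vertex] at h
      exact L.lab_eq_of_edge hbase (L.typ_lt u) (hspec q).1 h
    obtain ⟨q, hq⟩ := L.exists_packCoords hj hi hP
    have huv : u = v := by
      refine SimpleGraph.eq_of_adj_of_card_le (G := L.graph) (S := S) w
        (fun u i i' h h' => L.packCoords_injective ((hw u i h).symm.trans (hw u i' h')))
        (fun q => by simpa using hS.exists_adj hnt (w q)) (by rwa [card_index]) (i := q) hu hv ?_ ?_
      · rw [adj_iff]
        simpa only [w, col_vertex, blk_vertex, typ_vertex, hq] using h₁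
      · rw [adj_iff]
        simpa only [w, col_vertex, blk_vertex, typ_vertex, hq] using h₂
    subst huv
    exact ⟨rfl, rfl, rfl⟩
  have root : ∀ j i, j ≤ L.M → i < L.W → L.In S j i 0 := by
    intro j i hj hi
    obtain ⟨j', i', t', hin, -, hE⟩ := dom j i 1 hj hi (L.lt_K (by omega))
    have : j' = j ∧ i' = i ∧ t' = 0 := by
      unfold Edge RowEdge SelectorEdge CheckEdge at hE
      omega
    obtain ⟨rfl, rfl, rfl⟩ := this
    exact hin
  -- If both middle vertices were chosen, each would be the only chosen neighbor of the other. They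
  -- would form a component without a root.
  have f₁ : ∀ j r, j < L.M → r < L.R → L.In S j r 5 → ¬ L.In S (j + 1) r 3 := by
    intro j r hj hr h5 h3
    have hrW := L.lt_W_of_lt_R hr
    have e53 : L.Edge j r 5 (j + 1) r 3 := by unfold Edge RowEdge; omega
    obtain ⟨u, hu, hu1, hu2, hu3⟩ := h5
    let P : Fin L.N → Prop := fun u => (L.col u = j ∧ L.blk u = r ∧ L.typ u = 5) ∨
      (L.col u = j + 1 ∧ L.blk u = r ∧ L.typ u = 3)
    have key := SimpleGraph.forall_of_connected_induce hS.2 (P := P) (u := u) (by simpa using hu)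
      (Or.inl ⟨hu1, hu2, hu3⟩) (by
        intro x hx y hy hPx hxy
        rw [adj_iff] at hxy
        have hy' : L.In S (L.col y) (L.blk y) (L.typ y) := ⟨y, by simpa using hy, rfl, rfl, rfl⟩
        rcases hPx with ⟨h1, h2, h3'⟩ | ⟨h1, h2, h3'⟩
        · rw [h1, h2, h3'] at hxy
          exact Or.inr (uniq j r 5 (by omega) hrW (by unfold Pack; omega) _ _ _ _ _ _ hy' h3 hxy
            (Or.inl e53))
        · rw [h1, h2, h3'] at hxy
          exact Or.inl (uniq (j + 1) r 3 (by omega) hrW (by unfold Pack; omega) _ _ _ _ _ _ hy'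
            ⟨u, hu, hu1, hu2, hu3⟩ hxy (Or.inr e53)))
    obtain ⟨v, hv, -, -, hv3⟩ := root 0 0 (by omega) L.W_pos
    rcases key v (by simpa using hv) with h | h <;> omega
  have f₂ : ∀ j r, j < L.M → r < L.R → L.In S j r 4 → ¬ L.In S (j + 1) r 3 := by
    intro j r hj hr h4 h3
    have := uniq j r 5 (by omega) (L.lt_W_of_lt_R hr) (by unfold Pack; omega) _ _ _ _ _ _ h4 h3
      (by unfold Edge RowEdge; omega) (by unfold Edge RowEdge; omega)
    omega
  have f₃ : ∀ j r, j < L.M → r < L.R → L.In S j r 5 → ¬ L.In S (j + 1) r 2 := by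
    intro j r hj hr h5 h2
    have := uniq (j + 1) r 3 (by omega) (L.lt_W_of_lt_R hr) (by unfold Pack; omega) _ _ _ _ _ _
      h5 h2 (by unfold Edge RowEdge; omega) (by unfold Edge RowEdge; omega)
    omega
  -- The state between columns `j` and `j + 1`. The value `1` is a default: `2` and `4` need not be
  -- chosen then, as a comparison or check vertex may take their place. Only the implications `g2`
  -- to `g5` are used.
  let c : ℕ → ℕ → ℕ := fun j r => if L.In S j r 5 then 2 else if L.In S (j + 1) r 3 then 0 else 1
  have g4 : ∀ j r, j < L.M → r < L.R → L.In S j r 4 → 1 ≤ c j r := by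
    intro j r hj hr h
    simp only [c, f₂ j r hj hr h, if_false]
    split_ifs <;> omega
  have g5 : ∀ j r, L.In S j r 5 → c j r = 2 := fun j r h => by simp only [c, h, if_true]
  have g2 : ∀ j r, j < L.M → r < L.R → L.In S (j + 1) r 2 → c j r ≤ 1 := by
    intro j r hj hr h
    have : ¬ L.In S j r 5 := fun h5 => f₃ j r hj hr h5 h
    simp only [c, this, if_false]
    split_ifs <;> omega
  have g3 : ∀ j r, j < L.M → r < L.R → L.In S (j + 1) r 3 → c j r = 0 := by
    intro j r hj hr h
    have : ¬ L.In S j r 5 := fun h5 => f₁ j r hj hr h5 h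
    simp only [c, this, h, if_false, if_true]
  have c_le : ∀ j r, c j r ≤ 2 := by
    intro j r
    simp only [c]
    split_ifs <;> omega
  refine ⟨c, c_le, ?_, ?_⟩
  · intro j r hj hr
    -- Vertex `6` says that the old state is at most `1` or the new one is `2`; vertex `7` says that
    -- the old state is `0` or the new one is at least `1`. Together they say that the state does
    -- not decrease.
    have h6 : L.In S (j + 1) r 2 ∨ L.In S (j + 1) r 5 := by
      obtain ⟨j', i', t', hin, -, hE⟩ := dom (j + 1) r 6 hj.le (L.lt_W_of_lt_R hr) (L.lt_K (by omega))
      have : j' = j + 1 ∧ i' = r ∧ (t' = 2 ∨ t' = 5) := by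
        unfold Edge RowEdge SelectorEdge CheckEdge Inner at hE
        omega
      obtain ⟨rfl, rfl, rfl | rfl⟩ := this
      · exact Or.inl hin
      · exact Or.inr hin
    have h7 : L.In S (j + 1) r 3 ∨ L.In S (j + 1) r 4 := by
      obtain ⟨j', i', t', hin, -, hE⟩ := dom (j + 1) r 7 hj.le (L.lt_W_of_lt_R hr) (L.lt_K (by omega))
      have : j' = j + 1 ∧ i' = r ∧ (t' = 3 ∨ t' = 4) := by
        unfold Edge RowEdge SelectorEdge CheckEdge Inner at hE
        omega
      obtain ⟨rfl, rfl, rfl | rfl⟩ := this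
      · exact Or.inl hin
      · exact Or.inr hin
    have := c_le j r
    rcases h6 with h6 | h6
    · have a := g2 j r (by omega) hr h6
      rcases h7 with h7 | h7
      · have b := g3 j r (by omega) hr h7
        omega
      · have b := g4 (j + 1) r hj hr h7
        omega
    · have a := g5 (j + 1) r h6
      omega
  · intro j hj
    obtain ⟨x, hx, hact, hin⟩ : ∃ x < L.D, L.act (j + 1) x ∧ L.In S (j + 1) (L.R + x) 3 := by
      obtain ⟨j', i', t', hin, ht', hE⟩ := dom (j + 1) (L.R + L.D) 2 hj.le (by unfold W; omega)
        (L.lt_K (by omega))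
      have : L.R ≤ i' ∧ i' < L.R + L.D ∧ L.act j' (i' - L.R) ∧ j' = j + 1 ∧ t' = 3 := by
        unfold Edge RowEdge SelectorEdge CheckEdge Inner at hE
        rcases hE with (hE | hE | hE | hE | hE) | (hE | hE | hE | hE | ⟨h1, h2, h3, h4, hE⟩) <;>
          first
          | omega
          | (have hb := hbase j' (i' - L.R) (t' - (8 + L.p)) h4
             unfold K at ht'
             exact ⟨h1, h2, h4, by omega⟩)
      obtain ⟨h1, h2, h3, rfl, rfl⟩ := this
      exact ⟨i' - L.R, by omega, h3, by rwa [Nat.add_sub_of_le h1]⟩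
    -- Vertices `3` and `4` are both neighbors of the packed vertex `2`. So a selected selector
    -- loses the vertex that dominates all its check vertices, and these must be dominated by row
    -- vertices.
    have hn4 : ¬ L.In S (j + 1) (L.R + x) 4 := by
      intro h4
      have := uniq (j + 1) (L.R + x) 2 hj.le (L.add_lt_W hx) (by unfold Pack; omega) _ _ _ _ _ _
        hin h4 (by unfold Edge SelectorEdge; omega) (by unfold Edge SelectorEdge; omega)
      omega
    refine ⟨x, hx, hact, fun r hr => ?_⟩
    have hbr := hbase _ _ r hact hr
    have hd := hdig x r
    constructor
    · by_cases h2 : L.dig x r = 2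
      · rw [h2]
        exact c_le _ _
      obtain ⟨j', i', t', hin', -, hE⟩ := dom (j + 1) (L.R + x) (8 + L.p + r) hj.le (L.add_lt_W hx)
        (L.lt_K (by omega))
      have : j' = j + 1 ∧ (i' = L.base (j + 1) x + r ∧
          (L.dig x r = 1 ∧ t' = 2 ∨ L.dig x r = 0 ∧ t' = 3) ∨ i' = L.R + x ∧ t' = 4) := by
        unfold Edge RowEdge SelectorEdge CheckEdge Inner at hE
        have e1 : 8 + L.p + r - (8 + L.p) = r := by omega
        have e2 : L.R + x - L.R = x := by omega
        rw [e1, e2] at hE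
        rcases hE with (hE | hE | hE | hE | hE) | (hE | hE | hE | hE | hE) <;>
          first | omega | grind
      obtain ⟨rfl, ⟨rfl, ⟨h, rfl⟩ | ⟨h, rfl⟩⟩ | ⟨rfl, rfl⟩⟩ := this
      · rw [h]
        exact g2 _ _ (by omega) hbr hin'
      · rw [g3 _ _ (by omega) hbr hin']
        exact Nat.zero_le _
      · exact absurd hin' hn4
    · by_cases h0 : L.dig x r = 0
      · rw [h0]
        exact Nat.zero_le _
      obtain ⟨j', i', t', hin', -, hE⟩ := dom (j + 1) (L.R + x) (8 + r) hj.le (L.add_lt_W hx)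
        (L.lt_K (by omega))
      have : j' = j + 1 ∧ (i' = L.base (j + 1) x + r ∧
          (L.dig x r = 1 ∧ t' = 4 ∨ L.dig x r = 2 ∧ t' = 5) ∨ i' = L.R + x ∧ t' = 4) := by
        unfold Edge RowEdge SelectorEdge CheckEdge Inner at hE
        have e1 : 8 + r - 8 = r := by omega
        have e2 : L.R + x - L.R = x := by omega
        rw [e1, e2] at hE
        rcases hE with (hE | hE | hE | hE | hE) | (hE | hE | hE | hE | hE) <;>
          first | omega | grind
      obtain ⟨rfl, ⟨rfl, ⟨h, rfl⟩ | ⟨h, rfl⟩⟩ | ⟨rfl, rfl⟩⟩ := this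
      · rw [h]
        exact g4 _ _ hj hbr hin'
      · rw [h, g5 _ _ hin']
      · exact absurd hin' hn4

end Layout

/-! ### From row states to a connected dominating set -/

namespace Layout

variable (L : Layout)

/-- The dominating set that belongs to the states `c` of the rows and the choice `sel` of a selector
in every column. -/
def choice (c sel : ℕ → ℕ) : L.Index → Fin L.N
  | .inl (j, i) => L.vertex j i 0 (Nat.lt_succ_iff.mp j.2) i.2 L.K_pos
  | .inr (.inl (j, r)) =>
    if c r = 0 then L.vertex (j + 1) r 3 j.2 (L.lt_W_of_lt_R r.2) (L.lt_K (by omega))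
    else L.vertex j r 4 j.2.le (L.lt_W_of_lt_R r.2) (L.lt_K (by omega))
  | .inr (.inr (.inl (j, r))) =>
    if c r = 2 then L.vertex j r 5 j.2.le (L.lt_W_of_lt_R r.2) (L.lt_K (by omega))
    else L.vertex (j + 1) r 2 j.2 (L.lt_W_of_lt_R r.2) (L.lt_K (by omega))
  | .inr (.inr (.inr (j, x))) =>
    if 0 < (j : ℕ) ∧ (j : ℕ) < L.M ∧ (x : ℕ) = sel j then
      L.vertex j (L.R + x) 3 (Nat.lt_succ_iff.mp j.2) (L.add_lt_W x.2) (L.lt_K (by omega))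
    else L.vertex j (L.R + x) 4 (Nat.lt_succ_iff.mp j.2) (L.add_lt_W x.2) (L.lt_K (by omega))

/-- The vertices of `choice`. -/
def choiceSet (c sel : ℕ → ℕ) : Finset (Fin L.N) :=
  open Classical in Finset.univ.image (L.choice c sel)

theorem choice_mem (c sel : ℕ → ℕ) (q : L.Index) : L.choice c sel q ∈ L.choiceSet c sel := by
  classical
  exact Finset.mem_image_of_mem _ (Finset.mem_univ q)

section

variable {L} {c sel : ℕ → ℕ} {j r : ℕ}

theorem in_root (hj : j ≤ L.M) (hi : r < L.W) : L.In (L.choiceSet c sel) j r 0 :=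
  ⟨_, L.choice_mem c sel (.inl (⟨j, by omega⟩, ⟨r, hi⟩)), by simp [choice]⟩

theorem in_three (hj : j < L.M) (hr : r < L.R) (h : c r = 0) :
    L.In (L.choiceSet c sel) (j + 1) r 3 :=
  ⟨_, L.choice_mem c sel (.inr (.inl (⟨j, hj⟩, ⟨r, hr⟩))), by simp [choice, h]⟩

theorem in_four (hj : j < L.M) (hr : r < L.R) (h : c r ≠ 0) : L.In (L.choiceSet c sel) j r 4 :=
  ⟨_, L.choice_mem c sel (.inr (.inl (⟨j, hj⟩, ⟨r, hr⟩))), by simp [choice, h]⟩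

theorem in_five (hj : j < L.M) (hr : r < L.R) (h : c r = 2) : L.In (L.choiceSet c sel) j r 5 :=
  ⟨_, L.choice_mem c sel (.inr (.inr (.inl (⟨j, hj⟩, ⟨r, hr⟩)))), by simp [choice, h]⟩

theorem in_two (hj : j < L.M) (hr : r < L.R) (h : c r ≠ 2) :
    L.In (L.choiceSet c sel) (j + 1) r 2 :=
  ⟨_, L.choice_mem c sel (.inr (.inr (.inl (⟨j, hj⟩, ⟨r, hr⟩)))), by simp [choice, h]⟩

theorem in_selected (h0 : 0 < j) (hj : j < L.M) (hD : sel j < L.D) :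
    L.In (L.choiceSet c sel) j (L.R + sel j) 3 :=
  ⟨_, L.choice_mem c sel (.inr (.inr (.inr (⟨j, by omega⟩, ⟨sel j, hD⟩)))), by
    simp [choice, h0, hj]⟩

theorem in_not_selected {x : ℕ} (hj : j ≤ L.M) (hx : x < L.D)
    (h : ¬ (0 < j ∧ j < L.M ∧ x = sel j)) : L.In (L.choiceSet c sel) j (L.R + x) 4 :=
  ⟨_, L.choice_mem c sel (.inr (.inr (.inr (⟨j, by omega⟩, ⟨x, hx⟩)))), by simp [choice, h]⟩

end

variable {L} in
theorem edge_row {j i t t' : ℕ} (hi : i < L.R) (h : t = 2 ∧ t' = 3 ∨ t = 4 ∧ t' = 5 ∨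
    t = 6 ∧ (t' = 2 ∨ t' = 5) ∨ t = 7 ∧ (t' = 3 ∨ t' = 4)) : L.Edge j i t j i t' :=
  Or.inr (Or.inr (Or.inl ⟨hi, rfl, Or.inl ⟨rfl, h⟩⟩))

variable {L} in
theorem edge_next {j i : ℕ} (hi : i < L.R) : L.Edge j i 5 (j + 1) i 3 :=
  Or.inr (Or.inr (Or.inl ⟨hi, rfl, Or.inr ⟨rfl, rfl, rfl⟩⟩))

variable {L} in
theorem edge_selector {j x t t' : ℕ} (hx : x < L.D)
    (h : t = 2 ∧ (t' = 3 ∨ t' = 4) ∨ t = 4 ∧ 8 ≤ t') :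
    L.Edge j (L.R + x) t j (L.R + x) t' :=
  Or.inr (Or.inr (Or.inr (Or.inl ⟨by omega, by omega, rfl, rfl, h⟩)))

/-- Only vertices not attached to their root need an argument. As the states are the same in all
columns, a comparison vertex finds `5` or `2`, respectively `3` or `4`, according to the state. The
check vertices of an unselected selector are dominated by its vertex `4`, and those of the selected
one by rows, whose states equal its digits. -/
theorem isDominatingSet_choiceSet (c sel : ℕ → ℕ) (hc : ∀ r, c r ≤ 2)
    (hbase : ∀ j x r, L.act j x → r < L.p → L.base j x + r < L.R)
    (hsel : ∀ j, 0 < j → j < L.M → sel j < L.D ∧ L.act j (sel j) ∧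
      ∀ r < L.p, c (L.base j (sel j) + r) = L.dig (sel j) r) :
    L.graph.IsDominatingSet (L.choiceSet c sel : Set (Fin L.N)) := by
  intro u hu
  have hj := L.col_le u
  have hi := L.blk_lt u
  have ht := L.typ_lt u
  have hu' : L.typ u ≠ 0 := by
    intro h
    obtain ⟨v, hv, h1, h2, h3⟩ := in_root hj hi
    have : v = u := Fin.ext (L.eq_of_coords h1 h2 (h3.trans h.symm))
    exact hu (this ▸ hv)
  suffices h : ∃ j' i' t', L.In (L.choiceSet c sel) j' i' t' ∧
      (L.Edge (L.col u) (L.blk u) (L.typ u) j' i' t' ∨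
        L.Edge j' i' t' (L.col u) (L.blk u) (L.typ u)) by
    obtain ⟨_, _, _, ⟨v, hv, rfl, rfl, rfl⟩, h⟩ := h
    exact ⟨v, by simpa using hv, (L.adj_iff u v).mpr h⟩
  generalize L.col u = j at *
  generalize L.blk u = i at *
  generalize L.typ u = t at *
  by_cases hin : L.Inner j i t
  swap
  · exact ⟨j, i, 0, in_root hj hi, Or.inr (Or.inr (Or.inl ⟨rfl, rfl, rfl, hu', hin⟩))⟩
  rcases hin with ⟨hr, ⟨rfl, h0⟩ | ⟨rfl, hM⟩ | ⟨rfl | rfl, h0, hM⟩⟩ | ⟨hR, hD, h⟩ |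
    ⟨rfl, rfl, h0, hM⟩
  · obtain ⟨j, rfl⟩ : ∃ j', j = j' + 1 := ⟨j - 1, by omega⟩
    by_cases h2 : c i = 2
    · exact ⟨j, i, 5, in_five hj hr h2, Or.inr (edge_next hr)⟩
    · exact ⟨j + 1, i, 2, in_two hj hr h2, Or.inr (edge_row hr (by decide))⟩
  · by_cases h0 : c i = 0
    · exact ⟨j + 1, i, 3, in_three hM hr h0, Or.inl (edge_next hr)⟩
    · exact ⟨j, i, 4, in_four hM hr h0, Or.inr (edge_row hr (by decide))⟩
  · obtain ⟨j, rfl⟩ : ∃ j', j = j' + 1 := ⟨j - 1, by omega⟩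
    by_cases h2 : c i = 2
    · exact ⟨j + 1, i, 5, in_five hM hr h2, Or.inl (edge_row hr (by decide))⟩
    · exact ⟨j + 1, i, 2, in_two (by omega) hr h2, Or.inl (edge_row hr (by decide))⟩
  · obtain ⟨j, rfl⟩ : ∃ j', j = j' + 1 := ⟨j - 1, by omega⟩
    by_cases h2 : c i = 0
    · exact ⟨j + 1, i, 3, in_three (by omega) hr h2, Or.inl (edge_row hr (by decide))⟩
    · exact ⟨j + 1, i, 4, in_four hM hr h2, Or.inl (edge_row hr (by decide))⟩
  · obtain ⟨x, rfl⟩ : ∃ x, i = L.R + x := ⟨i - L.R, by omega⟩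
    have hx : x < L.D := by omega
    rw [Nat.add_sub_cancel_left] at h
    by_cases hch : 0 < j ∧ j < L.M ∧ x = sel j
    · obtain ⟨h0, hM, rfl⟩ := hch
      obtain ⟨-, ha, hd⟩ := hsel j h0 hM
      rcases h with rfl | ⟨-, ⟨h8, hp, hne⟩ | ⟨hp, hne⟩⟩
      · exact ⟨j, L.R + sel j, 3, in_selected h0 hM (hsel j h0 hM).1, Or.inl (edge_selector (hsel j h0 hM).1 (by decide))⟩
      · obtain ⟨r, rfl⟩ : ∃ r, t = 8 + r := ⟨t - 8, by omega⟩
        rw [Nat.add_sub_cancel_left] at hne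
        have hr : r < L.p := by omega
        have hb := hbase j _ r ha hr
        have hcr := hd r hr
        have hle := hc (L.base j (sel j) + r)
        rcases (by omega : L.dig (sel j) r = 1 ∨ L.dig (sel j) r = 2) with h1 | h2
        · refine ⟨j, L.base j (sel j) + r, 4, in_four hM hb (by omega), Or.inl ?_⟩
          refine Or.inr (Or.inr (Or.inr (Or.inr ⟨hR, hD, rfl, ?_⟩)))
          simp only [Nat.add_sub_cancel_left]
          exact ⟨ha, Or.inr (Or.inl ⟨h8, hp, trivial, Or.inl ⟨h1, trivial⟩⟩)⟩
        · refine ⟨j, L.base j (sel j) + r, 5, in_five hM hb (by omega), Or.inl ?_⟩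
          refine Or.inr (Or.inr (Or.inr (Or.inr ⟨hR, hD, rfl, ?_⟩)))
          simp only [Nat.add_sub_cancel_left]
          exact ⟨ha, Or.inr (Or.inl ⟨h8, hp, trivial, Or.inr ⟨h2, trivial⟩⟩)⟩
      · obtain ⟨r, rfl⟩ : ∃ r, t = 8 + L.p + r := ⟨t - (8 + L.p), by omega⟩
        rw [Nat.add_sub_cancel_left] at hne
        have hr : r < L.p := by unfold K at ht; omega
        have hb := hbase j _ r ha hr
        have hcr := hd r hr
        have hle := hc (L.base j (sel j) + r)
        obtain ⟨j', rfl⟩ : ∃ j', j = j' + 1 := ⟨j - 1, by omega⟩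
        rcases (by omega : L.dig (sel (j' + 1)) r = 1 ∨ L.dig (sel (j' + 1)) r = 0) with h1 | h2
        · refine ⟨j' + 1, _, 2, in_two (by omega) hb (by omega), Or.inl ?_⟩
          refine Or.inr (Or.inr (Or.inr (Or.inr ⟨hR, hD, rfl, ?_⟩)))
          simp only [Nat.add_sub_cancel_left]
          exact ⟨ha, Or.inr (Or.inr ⟨hp, trivial, Or.inl ⟨h1, trivial⟩⟩)⟩
        · refine ⟨j' + 1, _, 3, in_three (by omega) hb (by omega), Or.inl ?_⟩
          refine Or.inr (Or.inr (Or.inr (Or.inr ⟨hR, hD, rfl, ?_⟩)))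
          simp only [Nat.add_sub_cancel_left]
          exact ⟨ha, Or.inr (Or.inr ⟨hp, trivial, Or.inr ⟨h2, trivial⟩⟩)⟩
    · refine ⟨j, L.R + x, 4, in_not_selected hj hx hch, ?_⟩
      rcases h with rfl | ⟨-, h⟩
      · exact Or.inl (edge_selector hx (by decide))
      · exact Or.inr (edge_selector hx (by omega))
  · obtain ⟨hx, ha, -⟩ := hsel j h0 hM
    refine ⟨j, L.R + sel j, 3, in_selected h0 hM (hsel j h0 hM).1, Or.inr ?_⟩
    refine Or.inr (Or.inr (Or.inr (Or.inr ⟨by omega, by omega, rfl, ?_⟩)))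
    simp only [Nat.add_sub_cancel_left]
    exact ⟨ha, Or.inl (by simp)⟩

/-- The roots form a path through all blocks. The only chosen vertices not attached to the root of
their block are `3` in state `0` and `5` in state `2`; these hang on the chosen vertices `2` and `4`
of the same block. -/
theorem connected_induce_choiceSet (c sel : ℕ → ℕ) :
    (L.graph.induce (L.choiceSet c sel : Set (Fin L.N))).Connected := by
  classical
  obtain ⟨v₀, hv₀, h₀⟩ := in_root (L := L) (c := c) (sel := sel) (Nat.zero_le _) L.W_pos
  let P : Fin L.N → Prop := fun u => ∃ h : u ∈ (L.choiceSet c sel : Set (Fin L.N)),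
    (L.graph.induce (L.choiceSet c sel : Set (Fin L.N))).Reachable ⟨v₀, by simpa using hv₀⟩ ⟨u, h⟩
  have step : ∀ u v, P u → v ∈ L.choiceSet c sel → L.graph.Adj u v → P v := by
    rintro u v ⟨hu, hreach⟩ hv hadj
    refine ⟨by simpa using hv, hreach.trans (SimpleGraph.Adj.reachable ?_)⟩
    simpa using hadj
  let Q : ℕ → ℕ → ℕ → Prop := fun j i t => ∀ u ∈ L.choiceSet c sel, L.col u = j → L.blk u = i → L.typ u = t → P u
  have qstep : ∀ {j i t j' i' t'}, Q j i t → L.In (L.choiceSet c sel) j i t →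
      (L.Edge j i t j' i' t' ∨ L.Edge j' i' t' j i t) → Q j' i' t' := by
    rintro j i t j' i' t' hQ ⟨u, hu, rfl, rfl, rfl⟩ hE v hv rfl rfl rfl
    exact step u v (hQ u hu rfl rfl rfl) hv ((L.adj_iff u v).mpr hE)
  have q00 : Q 0 0 0 := by
    intro u hu h1 h2 h3
    have : v₀ = u := Fin.ext (L.eq_of_coords (h₀.1.trans h1.symm) (h₀.2.1.trans h2.symm)
      (h₀.2.2.trans h3.symm))
    subst this
    exact ⟨by simpa using hu, SimpleGraph.Reachable.refl _⟩
  have qrow : ∀ j, j ≤ L.M → Q j 0 0 → ∀ i, i < L.W → Q j i 0 := by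
    intro j hj hq i
    induction i with
    | zero => exact fun _ => hq
    | succ i ih =>
      intro hi
      exact qstep (ih (by omega)) (in_root hj (by omega)) (by unfold Edge; omega)
  have q0 : ∀ j, j ≤ L.M → ∀ i, i < L.W → Q j i 0 := by
    intro j
    induction j with
    | zero => exact fun hj => qrow 0 hj q00
    | succ j ih =>
      intro hj
      refine qrow (j + 1) hj ?_
      have hW := L.W_pos
      exact qstep (ih (by omega) (L.W - 1) (by omega)) (in_root (by omega) (by omega))
        (by unfold Edge; omega)
  have qroot : ∀ {j i t}, j ≤ L.M → i < L.W → t ≠ 0 → ¬ L.Inner j i t → Q j i t :=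
    fun hj hi ht hin => qstep (q0 _ hj _ hi) (in_root hj hi)
      (Or.inl (Or.inr (Or.inl ⟨rfl, rfl, rfl, ht, hin⟩)))
  have q2 : ∀ j r, j ≤ L.M → r < L.R → Q j r 2 := fun j r hj hr =>
    qroot hj (L.lt_W_of_lt_R hr) (by omega) (by unfold Inner; omega)
  have q4 : ∀ j r, j ≤ L.M → r < L.R → Q j r 4 := fun j r hj hr =>
    qroot hj (L.lt_W_of_lt_R hr) (by omega) (by unfold Inner; omega)
  have all : ∀ u ∈ L.choiceSet c sel, P u := by
    intro u hu
    obtain ⟨q, -, rfl⟩ := Finset.mem_image.mp hu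
    rcases q with ⟨j, i⟩ | ⟨j, r⟩ | ⟨j, r⟩ | ⟨j, x⟩ <;> simp only [choice] at hu ⊢
    · exact q0 j (by omega) i i.2 _ hu (col_vertex ..) (blk_vertex ..) (typ_vertex ..)
    · split_ifs at hu ⊢ with h
      · exact qstep (q2 (j + 1) r j.2 r.2) (in_two j.2 r.2 (by omega))
          (Or.inl (edge_row r.2 (t' := 3) (by decide)))
          _ hu (col_vertex ..) (blk_vertex ..) (typ_vertex ..)
      · exact q4 j r j.2.le r.2 _ hu (col_vertex ..) (blk_vertex ..) (typ_vertex ..)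
    · split_ifs at hu ⊢ with h
      · exact qstep (q4 j r j.2.le r.2) (in_four j.2 r.2 (by omega))
          (Or.inl (edge_row r.2 (t' := 5) (by decide)))
          _ hu (col_vertex ..) (blk_vertex ..) (typ_vertex ..)
      · exact q2 (j + 1) r j.2 r.2 _ hu (col_vertex ..) (blk_vertex ..) (typ_vertex ..)
    · split_ifs at hu ⊢ with h
      · exact qroot (j := j) (i := L.R + x) (t := 3) (by omega) (L.add_lt_W x.2) (by omega)
          (by unfold Inner; omega) _ hu (col_vertex ..) (blk_vertex ..) (typ_vertex ..)
      · exact qroot (j := j) (i := L.R + x) (t := 4) (by omega) (L.add_lt_W x.2) (by omega)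
          (by unfold Inner; omega) _ hu (col_vertex ..) (blk_vertex ..) (typ_vertex ..)
  have : Nonempty (L.choiceSet c sel : Set (Fin L.N)) := ⟨⟨v₀, by simpa using hv₀⟩⟩
  refine SimpleGraph.Connected.mk fun x y => ?_
  obtain ⟨_, hx⟩ := all x (x.2)
  obtain ⟨_, hy⟩ := all y (y.2)
  exact hx.symm.trans hy

/-- States of the rows that agree with an active selector in every column give a connected
dominating set within the budget. -/
theorem exists_isConnectedDominatingSet (c sel : ℕ → ℕ) (hc : ∀ r, c r ≤ 2)
    (hbase : ∀ j x r, L.act j x → r < L.p → L.base j x + r < L.R)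
    (hsel : ∀ j, 0 < j → j < L.M → sel j < L.D ∧ L.act j (sel j) ∧
      ∀ r < L.p, c (L.base j (sel j) + r) = L.dig (sel j) r) :
    ∃ S : Finset (Fin L.N), L.graph.IsConnectedDominatingSet (S : Set (Fin L.N)) ∧
      S.card ≤ L.budget := by
  classical
  refine ⟨L.choiceSet c sel, ⟨L.isDominatingSet_choiceSet c sel hc hbase hsel,
    L.connected_induce_choiceSet c sel⟩, ?_⟩
  rw [← card_index, ← Finset.card_univ]
  exact Finset.card_image_le

end Layout

/-! ### Cutwidth of the layout -/

namespace Layout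

variable (L : Layout)

theorem col_mono {u v : ℕ} (h : u ≤ v) : L.col u ≤ L.col v :=
  Nat.div_le_div_right (Nat.div_le_div_right h)

theorem blk_mono {u v : ℕ} (h : u ≤ v) (hc : L.col u = L.col v) : L.blk u ≤ L.blk v := by
  have h₁ : u / L.K ≤ v / L.K := Nat.div_le_div_right h
  rw [← Nat.div_add_mod (u / L.K) L.W, ← Nat.div_add_mod (v / L.K) L.W] at h₁
  unfold col at hc
  rw [hc] at h₁
  unfold blk
  omega

theorem typ_mono {u v : ℕ} (h : u ≤ v) (hc : L.col u = L.col v) (hb : L.blk u = L.blk v) :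
    L.typ u ≤ L.typ v := by
  have h₂ : u / L.K = v / L.K := by
    rw [← Nat.div_add_mod (u / L.K) L.W, ← Nat.div_add_mod (v / L.K) L.W]
    unfold col at hc
    unfold blk at hb
    rw [hc, hb]
  rw [← Nat.div_add_mod u L.K, ← Nat.div_add_mod v L.K, h₂] at h
  unfold typ
  omega

/-- Pairs of adjacent vertices on different sides of a cut. -/
def cutPairs (s : Fin L.N) : Set (Fin L.N × Fin L.N) :=
  {e | e.1 ≤ s ∧ s < e.2 ∧ L.graph.Adj e.1 e.2}

/-- The pairs that belong to edges between consecutive columns of a row. -/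
def cutRow (s : Fin L.N) : Set (Fin L.N × Fin L.N) :=
  {e | e.1 ≤ s ∧ s < e.2 ∧ L.blk e.1 < L.R ∧ L.blk e.2 = L.blk e.1 ∧ L.col e.2 = L.col e.1 + 1 ∧
    L.typ e.1 = 5 ∧ L.typ e.2 = 3}

/-- The pairs that belong to edges between consecutive roots. -/
def cutRoot (s : Fin L.N) : Set (Fin L.N × Fin L.N) :=
  {e | e.1 ≤ s ∧ s < e.2 ∧ L.typ e.1 = 0 ∧ L.typ e.2 = 0 ∧
    (L.col e.2 = L.col e.1 ∧ L.blk e.2 = L.blk e.1 + 1 ∨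
      L.col e.2 = L.col e.1 + 1 ∧ L.blk e.2 = 0 ∧ L.blk e.1 + 1 = L.W)}

/-- The pairs in a block. -/
def cutBlock (s : Fin L.N) : Set (Fin L.N × Fin L.N) :=
  {e | e.1 ≤ s ∧ s < e.2 ∧ L.col e.2 = L.col e.1 ∧ L.blk e.2 = L.blk e.1}

/-- The pairs that belong to edges between a selector and the clause vertex. -/
def cutClause (s : Fin L.N) : Set (Fin L.N × Fin L.N) :=
  {e | e.1 ≤ s ∧ s < e.2 ∧ L.R ≤ L.blk e.1 ∧ L.blk e.1 < L.R + L.D ∧ L.col e.2 = L.col e.1 ∧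
    L.blk e.2 = L.R + L.D ∧ L.typ e.1 = 3 ∧ L.typ e.2 = 2}

/-- The pairs that belong to edges between a row and a check vertex. -/
def cutCheck (s : Fin L.N) : Set (Fin L.N × Fin L.N) :=
  {e | e.1 ≤ s ∧ s < e.2 ∧ L.blk e.1 < L.R ∧
    L.CheckEdge (L.col e.2) (L.blk e.2) (L.typ e.2) (L.col e.1) (L.blk e.1) (L.typ e.1)}

/-- Vertices are numbered lexicographically by column, block and number in the block. Hence root
edges and edges between columns point forward, rows precede selectors, and the clause block comes
last in its column; this fixes which end of an edge lies left of the cut. -/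
theorem cutPairs_subset (hbase : ∀ j x r, L.act j x → r < L.p → L.base j x + r < L.R)
    (s : Fin L.N) : L.cutPairs s ⊆
      L.cutRow s ∪ (L.cutRoot s ∪ (L.cutBlock s ∪ (L.cutClause s ∪ L.cutCheck s))) := by
  rintro ⟨u, v⟩ ⟨hu, hv, hadj⟩
  have huv : (u : ℕ) ≤ v := (hu.trans hv.le)
  rw [adj_iff] at hadj
  have hcol := L.col_mono huv
  have hblk := L.blk_mono huv
  have htyp := L.typ_mono huv
  have hu3 := L.typ_lt u
  have hv3 := L.typ_lt v
  have hu2 := L.blk_lt u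
  have hv2 := L.blk_lt v
  simp only at hadj
  rcases hadj with (h | h | h | h | h) | (h | h | h | h | h)
  · exact Or.inr (Or.inl ⟨hu, hv, h.1, h.2.1, h.2.2⟩)
  · exact Or.inr (Or.inr (Or.inl ⟨hu, hv, h.1, h.2.1⟩))
  · obtain ⟨h1, h2, ⟨h3, -⟩ | h3⟩ := h
    · exact Or.inr (Or.inr (Or.inl ⟨hu, hv, h3, h2⟩))
    · exact Or.inl ⟨hu, hv, h1, h2, h3⟩
  · exact Or.inr (Or.inr (Or.inl ⟨hu, hv, h.2.2.2.1, h.2.2.1⟩))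
  · obtain ⟨h1, h2, h3, h4, h5⟩ := h
    have hb := hbase (L.col u) (L.blk u - L.R) (L.typ u - 8) h4
    have hb' := hbase (L.col u) (L.blk u - L.R) (L.typ u - (8 + L.p)) h4
    have := hblk h3.symm
    unfold K at hu3
    refine Or.inr (Or.inr (Or.inr (Or.inl ⟨hu, hv, h1, h2, h3, ?_⟩)))
    simp only
    omega
  · exfalso
    have : L.col u = L.col v → L.blk u ≤ L.blk v := hblk
    omega
  · exact Or.inr (Or.inr (Or.inl ⟨hu, hv, h.1.symm, h.2.1.symm⟩))
  · obtain ⟨h1, h2, ⟨h3, -⟩ | h3⟩ := h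
    · exact Or.inr (Or.inr (Or.inl ⟨hu, hv, h3.symm, h2.symm⟩))
    · omega
  · exact Or.inr (Or.inr (Or.inl ⟨hu, hv, h.2.2.2.1.symm, h.2.2.1.symm⟩))
  · refine Or.inr (Or.inr (Or.inr (Or.inr ⟨hu, hv, ?_, h⟩)))
    obtain ⟨h1, h2, h3, h4, h5⟩ := h
    have hb := hbase (L.col v) (L.blk v - L.R) (L.typ v - 8) h4
    have hb' := hbase (L.col v) (L.blk v - L.R) (L.typ v - (8 + L.p)) h4
    have := hblk h3
    unfold K at hv3
    simp only
    omega

theorem pair_ext {e f : Fin L.N × Fin L.N} (h₁ : L.col e.1 = L.col f.1)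
    (h₂ : L.blk e.1 = L.blk f.1) (h₃ : L.typ e.1 = L.typ f.1) (h₄ : L.col e.2 = L.col f.2)
    (h₅ : L.blk e.2 = L.blk f.2) (h₆ : L.typ e.2 = L.typ f.2) : e = f :=
  Prod.ext (Fin.ext (L.eq_of_coords h₁ h₂ h₃)) (Fin.ext (L.eq_of_coords h₄ h₅ h₆))

theorem ncard_le_of_injOn {α : Type*} {A : Set α} {f : α → ℕ} {m : ℕ} (hf : ∀ a ∈ A, f a < m)
    (hinj : Set.InjOn f A) : A.ncard ≤ m := by
  have h := Set.ncard_le_ncard_of_injOn (t := (Finset.range m : Set ℕ)) f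
    (fun a ha => by simpa using hf a ha) hinj (Finset.finite_toSet _)
  rwa [Set.ncard_coe_finset, Finset.card_range] at h

theorem eq_of_mul_add_eq {K a b a' b' : ℕ} (hb : b < K) (hb' : b' < K)
    (h : a * K + b = a' * K + b') : a = a' ∧ b = b' := by
  have hK : 0 < K := by omega
  have h1 := congrArg (· / K) h
  have h2 := congrArg (· % K) h
  simp only [mul_comm _ K, Nat.mul_add_div hK, Nat.mul_add_mod, Nat.div_eq_of_lt hb,
    Nat.div_eq_of_lt hb', Nat.mod_eq_of_lt hb, Nat.mod_eq_of_lt hb', add_zero] at h1 h2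
  exact ⟨h1, h2⟩

theorem mul_add_lt {K D a b : ℕ} (ha : a < D) (hb : b < K) : a * K + b < D * K := by
  have : (a + 1) * K ≤ D * K := Nat.mul_le_mul_right _ ha
  rw [Nat.succ_mul] at this
  omega

theorem ncard_cutRow (s : Fin L.N) : (L.cutRow s).ncard ≤ L.R := by
  refine ncard_le_of_injOn (f := fun e => L.blk e.1) (fun e he => he.2.2.1) ?_
  rintro ⟨u, v⟩ ⟨hu, hv, -, h2, h3, h4, h5⟩ ⟨u', v'⟩ ⟨hu', hv', -, h2', h3', h4', h5'⟩ h
  simp only at *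
  -- Within one block, `5` comes after `3`. So a `5` left of the cut lies in an earlier column than
  -- a `3` of the same row right of it. Applied crosswise to two crossing edges of a row, this makes
  -- them equal.
  have key : ∀ u v : Fin L.N, u ≤ s → s < v → L.blk u = L.blk v → L.typ u = 5 → L.typ v = 3 →
      L.col u < L.col v := by
    intro u v hu hv hb hu5 hv3
    have huv : (u : ℕ) ≤ v := hu.trans hv.le
    have h1 := L.col_mono huv
    have h2 := L.typ_mono huv
    by_contra hlt
    have := h2 (by omega) hb
    omega
  have k1 := key u v' hu hv' (by omega) h4 h5'
  have k2 := key u' v hu' hv (by omega) h4' h5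
  exact L.pair_ext (by simp only; omega) h (by simp only; omega) (by simp only; omega)
    (by simp only; omega) (by simp only; omega)

theorem ncard_cutRoot (s : Fin L.N) : (L.cutRoot s).ncard ≤ 1 := by
  refine ncard_le_of_injOn (f := fun _ => 0) (fun e he => Nat.one_pos) ?_
  rintro ⟨u, v⟩ ⟨hu, hv, h1, h2, h3⟩ ⟨u', v'⟩ ⟨hu', hv', h1', h2', h3'⟩ -
  simp only at *
  have key : ∀ u v : Fin L.N, u ≤ s → s < v → L.typ u = 0 → L.typ v = 0 →
      L.col u < L.col v ∨ L.col u = L.col v ∧ L.blk u < L.blk v := by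
    intro u v hu hv ht ht'
    have huv : (u : ℕ) ≤ v := hu.trans hv.le
    have h1 := L.col_mono huv
    have h2 := L.blk_mono huv
    by_contra hlt
    have h3 : L.col u = L.col v := by omega
    have h4 := h2 h3
    have : (u : ℕ) = v := L.eq_of_coords h3 (by omega) (ht.trans ht'.symm)
    have : (u : ℕ) < v := lt_of_le_of_lt hu hv
    omega
  have k1 := key u v' hu hv' h1 h2'
  have k2 := key u' v hu' hv h1' h2
  have w1 := L.blk_lt u
  have w2 := L.blk_lt u'
  have w3 := L.blk_lt v
  have w4 := L.blk_lt v'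
  exact L.pair_ext (by simp only; omega) (by simp only; omega) (by simp only; omega)
    (by simp only; omega) (by simp only; omega) (by simp only; omega)

theorem col_eq_of_cut {s u v : Fin L.N} (hu : u ≤ s) (hv : s < v) (h : L.col v = L.col u) :
    L.col u = L.col s := by
  have h1 := L.col_mono (show (u : ℕ) ≤ s from hu)
  have h2 := L.col_mono (show (s : ℕ) ≤ v from hv.le)
  omega

theorem ncard_cutBlock (s : Fin L.N) : (L.cutBlock s).ncard ≤ L.K * L.K := by
  refine ncard_le_of_injOn (f := fun e => L.typ e.1 * L.K + L.typ e.2)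
    (fun e _ => mul_add_lt (L.typ_lt _) (L.typ_lt _)) ?_
  rintro ⟨u, v⟩ ⟨hu, hv, h1, h2⟩ ⟨u', v'⟩ ⟨hu', hv', h1', h2'⟩ h
  simp only at *
  obtain ⟨e1, e2⟩ := eq_of_mul_add_eq (L.typ_lt _) (L.typ_lt _) h
  have c := L.col_eq_of_cut hu hv h1
  have c' := L.col_eq_of_cut hu' hv' h1'
  have b1 := L.blk_mono (show (u : ℕ) ≤ s from hu) (by omega)
  have b2 := L.blk_mono (show (s : ℕ) ≤ v from hv.le) (by omega)
  have b1' := L.blk_mono (show (u' : ℕ) ≤ s from hu') (by omega)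
  have b2' := L.blk_mono (show (s : ℕ) ≤ v' from hv'.le) (by omega)
  exact L.pair_ext (by simp only; omega) (by simp only; omega) (by simp only; omega)
    (by simp only; omega) (by simp only; omega) (by simp only; omega)

theorem ncard_cutClause (s : Fin L.N) : (L.cutClause s).ncard ≤ L.D := by
  refine ncard_le_of_injOn (f := fun e => L.blk e.1 - L.R) (fun e he => ?_) ?_
  · obtain ⟨-, -, h1, h2, -⟩ := he
    omega
  rintro ⟨u, v⟩ ⟨hu, hv, h1, h2, h3, h4, h5, h6⟩ ⟨u', v'⟩ ⟨hu', hv', h1', h2', h3', h4', h5', h6'⟩ h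
  simp only at *
  have c := L.col_eq_of_cut hu hv h3
  have c' := L.col_eq_of_cut hu' hv' h3'
  exact L.pair_ext (by simp only; omega) (by simp only; omega) (by simp only; omega)
    (by simp only; omega) (by simp only; omega) (by simp only; omega)

/-- The digit of a check vertex determines its only row neighbor, so the edge is known once its
check vertex is, and that lies in the column of `s`. -/
theorem ncard_cutCheck (s : Fin L.N) : (L.cutCheck s).ncard ≤ L.D * L.K := by
  refine ncard_le_of_injOn (f := fun e => (L.blk e.2 - L.R) * L.K + L.typ e.2) (fun e he => ?_) ?_
  · obtain ⟨-, -, -, h1, h2, -⟩ := he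
    exact mul_add_lt (by omega) (L.typ_lt _)
  rintro ⟨u, v⟩ ⟨hu, hv, hR, h1, h2, h3, -, h5⟩ ⟨u', v'⟩ ⟨hu', hv', hR', h1', h2', h3', -, h5'⟩ h
  simp only at *
  obtain ⟨e1, e2⟩ := eq_of_mul_add_eq (L.typ_lt _) (L.typ_lt _) h
  have c := L.col_eq_of_cut hu hv h3.symm
  have c' := L.col_eq_of_cut hu' hv' h3'.symm
  have ec : L.col v' = L.col v := by omega
  have eb : L.blk v' = L.blk v := by omega
  rw [ec, eb, ← e2] at h5'
  exact L.pair_ext (by simp only; omega) (by simp only; omega) (by simp only; omega)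
    (by simp only; omega) (by simp only; omega) (by simp only; omega)

/-- In the order of their numbers, the vertices have a cutwidth that exceeds the number of rows only
by a constant. -/
theorem arrangementCutwidth_le (hbase : ∀ j x r, L.act j x → r < L.p → L.base j x + r < L.R) :
    L.graph.arrangementCutwidth (Equiv.refl (Fin L.N)) ≤
      L.R + (1 + (L.K * L.K + (L.D + L.D * L.K))) := by
  refine Finset.sup_le fun s _ => ?_
  have hsub : L.graph.arrangementCut (Equiv.refl (Fin L.N)) s ⊆
      (fun e : Fin L.N × Fin L.N => s(e.1, e.2)) '' L.cutPairs s := by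
    rintro e ⟨he, j, k, hj, hk, rfl⟩
    exact ⟨(j, k), ⟨hj, hk, by simpa using he⟩, rfl⟩
  refine (Set.ncard_le_ncard hsub (Set.toFinite _)).trans ?_
  refine (Set.ncard_image_le (Set.toFinite _)).trans ?_
  refine (Set.ncard_le_ncard (L.cutPairs_subset hbase s) (Set.toFinite _)).trans ?_
  refine (Set.ncard_union_le _ _).trans (Nat.add_le_add (L.ncard_cutRow s) ?_)
  refine (Set.ncard_union_le _ _).trans (Nat.add_le_add (L.ncard_cutRoot s) ?_)
  refine (Set.ncard_union_le _ _).trans (Nat.add_le_add (L.ncard_cutBlock s) ?_)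
  exact (Set.ncard_union_le _ _).trans
    (Nat.add_le_add (L.ncard_cutClause s) (L.ncard_cutCheck s))

theorem cutwidth_le (hbase : ∀ j x r, L.act j x → r < L.p → L.base j x + r < L.R) :
    L.graph.cutwidth ≤ L.R + (1 + (L.K * L.K + (L.D + L.D * L.K))) :=
  (ciInf_le (OrderBot.bddBelow _) (Equiv.refl (Fin L.N))).trans (L.arrangementCutwidth_le hbase)

end Layout

/-! # The encoding of a formula -/

/-- Every clause announces its length, so each jump leads from one length cell to the next. -/
theorem CNFFormula.encode_start {n : ℕ} {w : ℕ → ℕ} : ∀ (cs : List (List (Fin n × Bool))) (k : ℕ),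
    (∀ i, w (k + i) = (cs.flatMap fun C =>
      C.length :: C.map fun l => 2 * (l.1 : ℕ) + l.2.toNat).getD i 0) →
    ∀ (q : ℕ) (hq : q < cs.length), w ((fun k => k + 1 + w k)^[q] k) = (cs[q]).length ∧
      ∀ (i : ℕ) (hi : i < (cs[q]).length), w ((fun k => k + 1 + w k)^[q] k + 1 + i) =
        2 * ((cs[q])[i].1 : ℕ) + (cs[q])[i].2.toNat := by
  intro cs
  induction cs with
  | nil => exact fun k _ q hq => absurd hq (Nat.not_lt_zero _)
  | cons C cs ih =>
    intro k hw q hq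
    simp only [List.flatMap_cons, List.cons_append] at hw
    have h0 : w k = C.length := by simpa using hw 0
    have h1 : ∀ i, w (k + 1 + i) = ((C.map fun l => 2 * (l.1 : ℕ) + l.2.toNat) ++
        cs.flatMap fun C => C.length :: C.map fun l => 2 * (l.1 : ℕ) + l.2.toNat).getD i 0 := by
      intro i
      rw [add_assoc, add_comm 1 i, hw (i + 1), List.getD_cons_succ]
    cases q with
    | zero =>
      refine ⟨h0, fun i hi => ?_⟩
      have hi' : i < C.length := hi
      simp only [Function.iterate_zero, id]
      rw [h1 i, List.getD_append _ _ _ _ (by simpa using hi')]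
      simp [hi']
    | succ q =>
      simp only [Function.iterate_succ_apply, h0]
      refine ih (k + 1 + C.length) (fun i => ?_) q (by simpa using hq)
      rw [add_assoc, h1, List.getD_append_right _ _ _ _ (by simp)]
      simp

/-! # The layout of a formula -/

/-- `b ^ i` for `i < n`, and `0` otherwise. -/
def powTable (b n i : ℕ) : ℕ := if i < n then b ^ i else 0

/-- The `i`-th literal of the `q`-th clause in an input `w`. -/
def inputLiteral (w : ℕ → ℕ) (q i : ℕ) : ℕ := w ((fun k => k + 1 + w k)^[q] 2 + 1 + i)

/-- The layout for an input `w` that encodes a formula with at most `d` literals in each clause.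
The variables are divided into groups of `t` variables, and the states of `p` rows encode an
assignment to the variables of a group. A selector stands for a literal of a clause and an assignment
to the group of its variable, and it takes part if the assignment makes the literal true. -/
def satLayout (p t d : ℕ) (w : ℕ → ℕ) : Layout where
  R := (w 0 / t + 1) * p
  p := p
  D := d * 3 ^ p
  M := (2 * ((w 0 / t + 1) * p) + 1) * w 1 + 1
  act j x := 0 < j ∧ j < (2 * ((w 0 / t + 1) * p) + 1) * w 1 + 1 ∧
    x / 3 ^ p < w ((fun k => k + 1 + w k)^[(j - 1) % w 1] 2) ∧
    x % 3 ^ p / powTable 2 t (inputLiteral w ((j - 1) % w 1) (x / 3 ^ p) / 2 % t) % 2 =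
      inputLiteral w ((j - 1) % w 1) (x / 3 ^ p) % 2
  base j x := inputLiteral w ((j - 1) % w 1) (x / 3 ^ p) / 2 / t * p
  dig x r := x % 3 ^ p / powTable 3 p r % 3

theorem exists_digits {b n : ℕ} (f : ℕ → ℕ) (hf : ∀ i, f i < b) :
    ∃ y < b ^ n, ∀ i < n, y / b ^ i % b = f i := by
  refine ⟨finFunctionFinEquiv (fun i : Fin n => (⟨f i, hf i⟩ : Fin b)), Fin.is_lt _, fun i hi => ?_⟩
  have := finFunctionFinEquiv_symm_apply_val
    (finFunctionFinEquiv (fun i : Fin n => (⟨f i, hf i⟩ : Fin b))) ⟨i, hi⟩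
  rw [Equiv.symm_apply_apply] at this
  exact this.symm

theorem eq_of_digits {b n x y : ℕ} (hx : x < b ^ n) (hy : y < b ^ n)
    (h : ∀ i < n, x / b ^ i % b = y / b ^ i % b) : x = y := by
  have : (⟨x, hx⟩ : Fin (b ^ n)) = ⟨y, hy⟩ := by
    refine finFunctionFinEquiv.symm.injective (funext fun i => Fin.ext ?_)
    rw [finFunctionFinEquiv_symm_apply_val, finFunctionFinEquiv_symm_apply_val]
    exact h i i.2
  simpa using this

/-- If every step were strict, the values would grow at least like the index, and `f (m + 1)` would
exceed `m`. -/
theorem exists_eq_succ_of_monotone {f : ℕ → ℕ} {m : ℕ} (hf : ∀ i < m + 1, f i ≤ f (i + 1))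
    (hm : f (m + 1) ≤ m) : ∃ i < m + 1, f i = f (i + 1) := by
  by_contra! hne
  have : ∀ i ≤ m + 1, i ≤ f i := by
    intro i
    induction i with
    | zero => exact fun _ => Nat.zero_le _
    | succ i ih =>
      intro hi
      have h1 := hf i (by omega)
      have h2 := hne i (by omega)
      have h3 := ih (by omega)
      omega
  have := this (m + 1) le_rfl
  omega

/-! ### Correctness of the reduction -/

section satLayout

variable {p t d : ℕ} (φ : CNFFormula)

/-- The input of a machine that is given a formula. -/
def CNFFormula.input : ℕ → ℕ := fun i => φ.encode.getD i 0

theorem CNFFormula.input_zero : φ.input 0 = φ.numVars := rfl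

theorem CNFFormula.input_one : φ.input 1 = φ.clauses.length := rfl

theorem CNFFormula.input_spec (q : ℕ) (hq : q < φ.clauses.length) :
    φ.input ((fun k => k + 1 + φ.input k)^[q] 2) = (φ.clauses[q]).length ∧
      ∀ (i : ℕ) (hi : i < (φ.clauses[q]).length), inputLiteral φ.input q i =
        2 * ((φ.clauses[q])[i].1 : ℕ) + (φ.clauses[q])[i].2.toNat := by
  refine CNFFormula.encode_start (w := φ.input) φ.clauses 2 (fun i => ?_) q hq
  rw [CNFFormula.input, CNFFormula.encode, add_comm, List.getD_cons_succ, List.getD_cons_succ]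

theorem satLayout_act_lt {j x : ℕ} (h : (satLayout p t d φ.input).act j x) :
    (j - 1) % φ.clauses.length < φ.clauses.length := by
  obtain ⟨h0, h1, -⟩ := h
  refine Nat.mod_lt _ (Nat.pos_of_ne_zero fun hm => ?_)
  rw [φ.input_one, hm] at h1
  omega

theorem satLayout_act_spec {j x : ℕ} (h : (satLayout p t d φ.input).act j x) :
    ∃ C ∈ φ.clauses, ∃ l ∈ C,
      (C = φ.clauses[(j - 1) % φ.clauses.length]'(satLayout_act_lt φ h)) ∧
      x % 3 ^ p / powTable 2 t ((l.1 : ℕ) % t) % 2 = l.2.toNat ∧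
      (satLayout p t d φ.input).base j x = (l.1 : ℕ) / t * p := by
  have hq := satLayout_act_lt φ h
  obtain ⟨h0, h1, h2, h3⟩ := h
  rw [φ.input_one] at h2 h3
  obtain ⟨s1, s2⟩ := φ.input_spec _ hq
  rw [s1] at h2
  have s3 := s2 _ h2
  refine ⟨_, List.getElem_mem hq, _, List.getElem_mem h2, rfl, ?_, ?_⟩
  · rw [s3] at h3
    generalize (φ.clauses[(j - 1) % φ.clauses.length])[x / 3 ^ p] = l at *
    have hb : l.2.toNat < 2 := Bool.toNat_lt _
    have e1 : (2 * (l.1 : ℕ) + l.2.toNat) / 2 = l.1 := by omega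
    have e2 : (2 * (l.1 : ℕ) + l.2.toNat) % 2 = l.2.toNat := by omega
    rwa [e1, e2] at h3
  · simp only [satLayout]
    rw [φ.input_one, s3]
    generalize (φ.clauses[(j - 1) % φ.clauses.length])[x / 3 ^ p] = l at *
    have hb : l.2.toNat < 2 := Bool.toNat_lt _
    have e1 : (2 * (l.1 : ℕ) + l.2.toNat) / 2 = l.1 := by omega
    rw [e1]

theorem satLayout_base_lt (j x r : ℕ) (h : (satLayout p t d φ.input).act j x)
    (hr : r < (satLayout p t d φ.input).p) :
    (satLayout p t d φ.input).base j x + r < (satLayout p t d φ.input).R := by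
  obtain ⟨C, -, l, -, -, -, hb⟩ := satLayout_act_spec φ h
  rw [hb]
  change _ < (φ.input 0 / t + 1) * p
  rw [φ.input_zero]
  have h1 : (l.1 : ℕ) / t ≤ φ.numVars / t := Nat.div_le_div_right l.1.2.le
  exact Layout.mul_add_lt (Nat.lt_succ_iff.mpr h1) hr

theorem satLayout_dig_le (x r : ℕ) : (satLayout p t d φ.input).dig x r ≤ 2 := by
  have : (satLayout p t d φ.input).dig x r < 3 := Nat.mod_lt _ (by omega)
  omega

theorem satisfiable_of_isConnectedDominatingSet (ht : 0 < t)
    {S : Finset (Fin (satLayout p t d φ.input).N)}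
    (hS : (satLayout p t d φ.input).graph.IsConnectedDominatingSet (S : Set _))
    (hcard : S.card ≤ (satLayout p t d φ.input).budget) : φ.Satisfiable := by
  set L := satLayout p t d φ.input with hL
  rcases Nat.eq_zero_or_pos φ.clauses.length with hm | hm
  · rw [List.length_eq_zero_iff] at hm
    exact ⟨fun _ => true, by simp [hm]⟩
  set m := φ.clauses.length with em
  have hLM : L.M = (2 * L.R + 1) * m + 1 := rfl
  obtain ⟨c, hc, hmono, hsel⟩ := L.exists_states (by omega) (satLayout_base_lt φ)
    (satLayout_dig_le φ) hS hcard
  have hmono' : ∀ r < L.R, ∀ i j, i ≤ j → j < L.M → c i r ≤ c j r := by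
    intro r hr i j hij
    induction j, hij using Nat.le_induction with
    | base => exact fun _ => le_rfl
    | succ j _ ih => exact fun hj => (ih (by omega)).trans (hmono j r hj hr)
  have hlt : ∀ h ≤ 2 * L.R + 1, h * m < L.M := fun h hh => by
    have := Nat.mul_le_mul_right m hh
    omega
  -- The sum of all states lies between `0` and `2 * L.R`, so one of the `2 * L.R + 1` repetitions
  -- leaves it unchanged. By monotonicity, no single state changes in this repetition either.
  obtain ⟨h, hh, heq⟩ : ∃ h < 2 * L.R + 1,
      ∑ r ∈ Finset.range L.R, c (h * m) r = ∑ r ∈ Finset.range L.R, c ((h + 1) * m) r := by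
    refine exists_eq_succ_of_monotone (f := fun h => ∑ r ∈ Finset.range L.R, c (h * m) r)
      (fun h hh => ?_) ?_
    · exact Finset.sum_le_sum fun r hr => hmono' r (Finset.mem_range.mp hr) _ _
        (Nat.mul_le_mul_right m (by omega)) (hlt _ hh)
    · refine (Finset.sum_le_card_nsmul _ _ 2 fun r _ => hc _ r).trans ?_
      simp [mul_comm]
  have heq' : ∀ r ∈ Finset.range L.R, c (h * m) r = c ((h + 1) * m) r := (Finset.sum_eq_sum_iff_of_le fun r hr => hmono' r (Finset.mem_range.mp hr) _ _
        (Nat.mul_le_mul_right m (by omega)) (hlt _ hh)).mp heq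
  have hdigits : ∀ g, ∃ y < 3 ^ p, ∀ r < p, y / 3 ^ r % 3 = c (h * m) (g * p + r) := fun g =>
    exists_digits (fun r => c (h * m) (g * p + r)) fun r => Nat.lt_succ_iff.mpr (hc _ _)
  choose y hy hy' using hdigits
  -- The assignment reads bit `v % t` of the number spelled by the rows of group `v / t`. This
  -- number may be `2 ^ t` or more; its low bits still give an assignment.
  refine ⟨fun v => decide (y (v / t) / 2 ^ ((v : ℕ) % t) % 2 = 1), fun C hC => ?_⟩
  obtain ⟨q, hq, rfl⟩ := List.getElem_of_mem hC
  have hjm : h * m + q + 1 ≤ (h + 1) * m := by rw [Nat.succ_mul]; omega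
  have hj : h * m + q + 1 < L.M := lt_of_le_of_lt hjm (hlt _ hh)
  obtain ⟨x, -, hact, hx⟩ := hsel (h * m + q) hj
  obtain ⟨C, -, l, hl, hCeq, hbit, hbase⟩ := satLayout_act_spec φ hact
  have hjq : (h * m + q + 1 - 1) % φ.clauses.length = q := by
    rw [Nat.add_sub_cancel, mul_comm, ← em, Nat.mul_add_mod, Nat.mod_eq_of_lt hq]
  simp only [hjq] at hCeq
  refine ⟨l, hCeq ▸ hl, ?_⟩
  -- The digits of the selector are caught between states of the repetition `h`, where the states
  -- are constant. So the selector carries exactly the assignment of its group.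
  have hxy : x % 3 ^ p = y (l.1 / t) := by
    refine eq_of_digits (Nat.mod_lt _ (by positivity)) (hy _) fun r hr => ?_
    have hbr := satLayout_base_lt φ _ x r hact hr
    rw [hbase] at hbr
    obtain ⟨h1, h2⟩ := hx r hr
    rw [hbase] at h1 h2
    have k1 := hmono' _ hbr (h * m) (h * m + q) (by omega) (by omega)
    have k2 := hmono' _ hbr (h * m + q + 1) ((h + 1) * m) hjm (hlt _ hh)
    have k3 := heq' _ (Finset.mem_range.mpr hbr)
    have k4 : L.dig x r = x % 3 ^ p / 3 ^ r % 3 := by simp [hL, satLayout, powTable, hr]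
    rw [hy' _ r hr, ← k4]
    omega
  rw [powTable, if_pos (Nat.mod_lt _ ht), hxy] at hbit
  change decide (y (l.1 / t) / 2 ^ ((l.1 : ℕ) % t) % 2 = 1) = l.2
  rw [hbit]
  cases l.2 <;> rfl

theorem exists_isConnectedDominatingSet_of_satisfiable (ht : 0 < t) (hpt : 2 ^ t ≤ 3 ^ p)
    (hd : ∀ C ∈ φ.clauses, C.length ≤ d) (hφ : φ.Satisfiable) :
    ∃ S : Finset (Fin (satLayout p t d φ.input).N),
      (satLayout p t d φ.input).graph.IsConnectedDominatingSet (S : Set _) ∧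
      S.card ≤ (satLayout p t d φ.input).budget := by
  set L := satLayout p t d φ.input with hL
  obtain ⟨a, ha⟩ := hφ
  set a' : ℕ → ℕ := fun v => if h : v < φ.numVars then (a ⟨v, h⟩).toNat else 0 with ea
  have ha' : ∀ v, a' v < 2 := by
    intro v
    simp only [ea]
    split_ifs
    · exact Bool.toNat_lt _
    · omega
  have hdigits : ∀ g, ∃ y < 2 ^ t, ∀ b < t, y / 2 ^ b % 2 = a' (g * t + b) := fun g =>
    exists_digits (fun b => a' (g * t + b)) fun b => ha' _
  choose y hy hy' using hdigits
  have hsel : ∀ j, 0 < j → j < L.M → ∃ x < L.D, L.act j x ∧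
      ∀ r < L.p, y ((L.base j x + r) / p) / 3 ^ ((L.base j x + r) % p) % 3 = L.dig x r := by
    intro j h0 hj
    set q := (j - 1) % φ.clauses.length with eq
    have hq : q < φ.clauses.length := by
      refine Nat.mod_lt _ (Nat.pos_of_ne_zero fun hm => ?_)
      have : L.M = (2 * L.R + 1) * φ.clauses.length + 1 := rfl
      rw [hm] at this
      omega
    obtain ⟨l, hl, hal⟩ := ha _ (List.getElem_mem hq)
    obtain ⟨i, hi, rfl⟩ := List.getElem_of_mem hl
    obtain ⟨s1, s2⟩ := φ.input_spec q hq
    have s3 := s2 i hi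
    generalize el : (φ.clauses[q])[i] = l at *
    have hyl : y (l.1 / t) < 3 ^ p := (hy _).trans_le hpt
    have hX : 0 < 3 ^ p := by positivity
    -- The selector for the true literal number `i` of the clause and the actual assignment to the
    -- group of its variable; `2 ^ t ≤ 3 ^ p` leaves room for that assignment.
    set x := i * 3 ^ p + y (l.1 / t) with ex
    have hxd : x / 3 ^ p = i := by
      rw [ex, mul_comm, Nat.mul_add_div hX, Nat.div_eq_of_lt hyl, add_zero]
    have hxm : x % 3 ^ p = y (l.1 / t) := by
      rw [ex, mul_comm, Nat.mul_add_mod, Nat.mod_eq_of_lt hyl]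
    have hb : l.2.toNat < 2 := Bool.toNat_lt _
    have e1 : (2 * (l.1 : ℕ) + l.2.toNat) / 2 = l.1 := by omega
    have e2 : (2 * (l.1 : ℕ) + l.2.toNat) % 2 = l.2.toNat := by omega
    have hbase : L.base j x = (l.1 : ℕ) / t * p := by
      simp only [hL, satLayout]
      rw [φ.input_one, hxd, ← eq, s3, e1]
    refine ⟨x, Layout.mul_add_lt (hi.trans_le (hd _ (List.getElem_mem hq))) hyl,
      ⟨h0, hj, ?_, ?_⟩, fun r hr => ?_⟩
    · rw [φ.input_one, hxd, ← eq, s1]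
      exact hi
    · rw [φ.input_one, hxd, ← eq, s3, e1, e2, hxm, powTable, if_pos (Nat.mod_lt _ ht),
        hy' _ _ (Nat.mod_lt _ ht), Nat.div_add_mod']
      simp only [ea, l.1.2, dif_pos]
      rw [← hal]
    · have hr' : r < p := hr
      have hp : 0 < p := by omega
      have k1 : ((l.1 : ℕ) / t * p + r) / p = l.1 / t := by
        rw [mul_comm, Nat.mul_add_div hp, Nat.div_eq_of_lt hr', add_zero]
      have k2 : ((l.1 : ℕ) / t * p + r) % p = r := by
        rw [mul_comm, Nat.mul_add_mod, Nat.mod_eq_of_lt hr']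
      rw [hbase, k1, k2]
      simp [hL, satLayout, powTable, hr', hxm]
  choose sel hsel using hsel
  -- Row `r` carries digit `r % p` of group `r / p`. The selector `0` outside of the inner columns
  -- is a dummy value.
  refine L.exists_isConnectedDominatingSet (fun r => y (r / p) / 3 ^ (r % p) % 3)
    (fun j => if h : 0 < j ∧ j < L.M then sel j h.1 h.2 else 0) (fun r => ?_)
    (satLayout_base_lt φ) (fun j h0 hj => ?_)
  · exact Nat.lt_succ_iff.mp (Nat.mod_lt _ (by omega))
  · simp only [h0, hj, and_self, dif_pos]
    exact hsel j h0 hj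

end satLayout

/-! # Terms that write down the graph of a layout -/

namespace RAM.Term

instance : Add Term := ⟨Term.op .add⟩
instance : Sub Term := ⟨Term.op .sub⟩
instance : Mul Term := ⟨Term.op .mul⟩
instance : Div Term := ⟨Term.op .div⟩
instance : Mod Term := ⟨Term.op .mod⟩
instance (n : ℕ) : OfNat Term n := ⟨Term.const n⟩

/-- Negation: `1` if the value is `0`, and `0` otherwise. -/
def not (e : Term) : Term := 1 - e

instance : AndOp Term := ⟨fun e f => e * f⟩
instance : OrOp Term := ⟨fun e f => e + f⟩

/-- Nonzero if `e < f`. -/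
def lt (e f : Term) : Term := f - e

/-- Nonzero if `e ≤ f`. -/
def le (e f : Term) : Term := not (lt f e)

/-- Nonzero if `e = f`. -/
def eq (e f : Term) : Term := not ((e - f) + (f - e))

/-- `e` if `c` is nonzero, and `f` otherwise. -/
def ite (c e f : Term) : Term := not (not c) * e + not c * f

/-- `powTable b n` as a term. -/
def pow (b : ℕ) (e : Term) : ℕ → Term
  | 0 => 0
  | n + 1 => pow b e n + eq e (.const n) * .const (b ^ n)

variable (w : ℕ → ℕ) (a : ℕ) (e f c : Term)

/-- The value of the term is not zero. -/
def Holds : Prop := e.eval w a ≠ 0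

@[simp] theorem eval_add : (e + f).eval w a = e.eval w a + f.eval w a := rfl
@[simp] theorem eval_sub : (e - f).eval w a = e.eval w a - f.eval w a := rfl
@[simp] theorem eval_mul : (e * f).eval w a = e.eval w a * f.eval w a := rfl
@[simp] theorem eval_div : (e / f).eval w a = e.eval w a / f.eval w a := rfl
@[simp] theorem eval_mod : (e % f).eval w a = e.eval w a % f.eval w a := rfl
@[simp] theorem eval_ofNat (n : ℕ) :
    Term.eval w a (no_index (OfNat.ofNat n)) = OfNat.ofNat n := rfl
@[simp] theorem eval_const (n : ℕ) : (Term.const n).eval w a = n := rfl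
@[simp] theorem eval_var : Term.var.eval w a = a := rfl
@[simp] theorem eval_inp : (Term.inp e).eval w a = w (e.eval w a) := rfl
@[simp] theorem eval_start :
    (Term.start e).eval w a = (fun q => q + 1 + w q)^[e.eval w a] 2 := rfl

@[simp] theorem holds_and : Holds w a (e &&& f) ↔ Holds w a e ∧ Holds w a f :=
  mul_ne_zero_iff

@[simp] theorem holds_or : Holds w a (e ||| f) ↔ Holds w a e ∨ Holds w a f := by
  have : (e ||| f).eval w a = e.eval w a + f.eval w a := rfl
  unfold Holds
  omega

@[simp] theorem holds_not : Holds w a (not e) ↔ ¬ Holds w a e := by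
  simp only [Holds, not, eval_sub, eval_ofNat]
  omega

@[simp] theorem holds_lt : Holds w a (lt e f) ↔ e.eval w a < f.eval w a := by
  simp only [Holds, lt, eval_sub]
  omega

@[simp] theorem holds_le : Holds w a (le e f) ↔ e.eval w a ≤ f.eval w a := by
  simp [le]

@[simp] theorem holds_eq : Holds w a (eq e f) ↔ e.eval w a = f.eval w a := by
  simp only [Holds, eq, not, eval_sub, eval_ofNat, eval_add]
  omega

open Classical in
theorem eval_not : (not e).eval w a = if Holds w a e then 0 else 1 := by
  have h : (not e).eval w a = 1 - e.eval w a := rfl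
  by_cases he : Holds w a e
  · have := Nat.pos_of_ne_zero he
    rw [if_pos he, h]
    omega
  · rw [if_neg he, h, not_not.mp he]

open Classical in
theorem eval_eq : (eq e f).eval w a = if e.eval w a = f.eval w a then 1 else 0 := by
  simp only [eq, not, eval_sub, eval_ofNat, eval_add]
  split_ifs <;> omega

open Classical in
@[simp] theorem eval_ite : (ite c e f).eval w a =
    if Holds w a c then e.eval w a else f.eval w a := by
  simp only [ite, eval_add, eval_mul, eval_not, holds_not]
  split_ifs <;> simp_all

@[simp] theorem eval_pow (b n : ℕ) : (pow b e n).eval w a = powTable b n (e.eval w a) := by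
  induction n with
  | zero => simp [pow, powTable]
  | succ n ih =>
    simp only [pow, eval_add, ih, eval_mul, eval_eq, eval_const, powTable]
    rcases lt_trichotomy (e.eval w a) n with h | h | h
    · simp [h, h.ne, h.trans n.lt_succ_self]
    · simp [h]
    · simp [h.ne', h.not_gt, (show ¬ e.eval w a < n + 1 by omega)]

end RAM.Term

namespace SatTerm

open RAM RAM.Term

variable (p t d : ℕ)

/-- The number of rows. -/
def rows : Term := (.inp 0 / .const t + 1) * .const p

/-- The number of selectors of a column. -/
def sels : Term := .const (d * 3 ^ p)

/-- The number of the last column. -/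
def last : Term := (2 * rows p t + 1) * .inp 1 + 1

/-- The number of blocks of a column. -/
def blocks : Term := rows p t + sels p d + 1

/-- The number of vertices of a block. -/
def types : Term := .const (8 + 2 * p)

/-- The number of vertices. -/
def verts : Term := (last p t + 1) * blocks p t d * types p

/-- The size of the dominating set. -/
def budget : Term :=
  (last p t + 1) * (blocks p t d + sels p d) + 2 * (last p t * rows p t)

/-- The literal that belongs to selector `x` in column `j`. -/
def lit (j x : Term) : Term :=
  .inp (.start ((j - 1) % .inp 1) + 1 + x / .const (3 ^ p))

/-- The condition that a selector takes part. -/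
def act (j x : Term) : Term :=
  lt 0 j &&& (lt j (last p t) &&&
    (lt (x / .const (3 ^ p)) (.inp (.start ((j - 1) % .inp 1))) &&&
      eq (x % .const (3 ^ p) / pow 2 (lit p j x / 2 % .const t) t % 2) (lit p j x % 2)))

/-- The first row of a selector. -/
def base (j x : Term) : Term := lit p j x / 2 / .const t * .const p

/-- The state that a selector checks. -/
def dig (x r : Term) : Term := x % .const (3 ^ p) / pow 3 r p % 3

/-- The term for `Layout.Inner`. -/
def inner (j i s : Term) : Term :=
  (lt i (rows p t) &&& ((eq s 3 &&& lt 0 j) ||| ((eq s 5 &&& lt j (last p t)) |||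
    ((eq s 6 ||| eq s 7) &&& (lt 0 j &&& lt j (last p t)))))) |||
  ((le (rows p t) i &&& (lt i (rows p t + sels p d) &&& (eq s 2 ||| (act p t j (i - rows p t) &&&
    ((le 8 s &&& (lt s (8 + .const p) &&& not (eq (dig p (i - rows p t) (s - 8)) 0))) |||
      (le (8 + .const p) s &&& not (eq (dig p (i - rows p t) (s - (8 + .const p))) 2))))))) |||
  (eq i (rows p t + sels p d) &&& (eq s 2 &&& (lt 0 j &&& lt j (last p t)))))

/-- The term for `Layout.RowEdge`. -/
def rowEdge (j i s j' i' s' : Term) : Term :=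
  lt i (rows p t) &&& (eq i' i &&&
    ((eq j' j &&& ((eq s 2 &&& eq s' 3) ||| ((eq s 4 &&& eq s' 5) |||
      ((eq s 6 &&& (eq s' 2 ||| eq s' 5)) ||| (eq s 7 &&& (eq s' 3 ||| eq s' 4)))))) |||
    (eq j' (j + 1) &&& (eq s 5 &&& eq s' 3))))

/-- The term for `Layout.SelectorEdge`. -/
def selectorEdge (j i s j' i' s' : Term) : Term :=
  le (rows p t) i &&& (lt i (rows p t + sels p d) &&& (eq i' i &&& (eq j' j &&&
    ((eq s 2 &&& (eq s' 3 ||| eq s' 4)) ||| (eq s 4 &&& le 8 s')))))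

/-- The term for `Layout.CheckEdge`. -/
def checkEdge (j i s j' i' s' : Term) : Term :=
  le (rows p t) i &&& (lt i (rows p t + sels p d) &&& (eq j' j &&& (act p t j (i - rows p t) &&&
    ((eq s 3 &&& (eq i' (rows p t + sels p d) &&& eq s' 2)) |||
      ((le 8 s &&& (lt s (8 + .const p) &&& (eq i' (base p t j (i - rows p t) + (s - 8)) &&&
        ((eq (dig p (i - rows p t) (s - 8)) 1 &&& eq s' 4) |||
          (eq (dig p (i - rows p t) (s - 8)) 2 &&& eq s' 5))))) |||
      (le (8 + .const p) s &&& (eq i' (base p t j (i - rows p t) + (s - (8 + .const p))) &&&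
        ((eq (dig p (i - rows p t) (s - (8 + .const p))) 1 &&& eq s' 2) |||
          (eq (dig p (i - rows p t) (s - (8 + .const p))) 0 &&& eq s' 3)))))))))

/-- The term for `Layout.Edge`. -/
def edge (j i s j' i' s' : Term) : Term :=
  (eq s 0 &&& (eq s' 0 &&& ((eq j' j &&& eq i' (i + 1)) |||
    (eq j' (j + 1) &&& (eq i' 0 &&& eq (i + 1) (blocks p t d)))))) |||
  ((eq j' j &&& (eq i' i &&& (eq s 0 &&& (not (eq s' 0) &&& not (inner p t d j i s'))))) |||
  (rowEdge p t j i s j' i' s' |||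
  (selectorEdge p t d j i s j' i' s' ||| checkEdge p t d j i s j' i' s')))

/-- The term for edges between vertices that are given by their numbers. -/
def edgeNum (u v : Term) : Term :=
  edge p t d (u / types p / blocks p t d) (u / types p % blocks p t d) (u % types p)
    (v / types p / blocks p t d) (v / types p % blocks p t d) (v % types p)

/-- The term for adjacency. -/
def adj (u v : Term) : Term := edgeNum p t d u v ||| edgeNum p t d v u

variable (w : ℕ → ℕ) (a : ℕ) (j i s j' i' s' x r : Term)

@[simp] theorem eval_rows : (rows p t).eval w a = (satLayout p t d w).R := rfl

@[simp] theorem eval_sels : (sels p d).eval w a = (satLayout p t d w).D := rfl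

@[simp] theorem eval_last : (last p t).eval w a = (satLayout p t d w).M := rfl

@[simp] theorem eval_blocks : (blocks p t d).eval w a = (satLayout p t d w).W := rfl

@[simp] theorem eval_types : (types p).eval w a = (satLayout p t d w).K := rfl

@[simp] theorem eval_verts : (verts p t d).eval w a = (satLayout p t d w).N := rfl

@[simp] theorem eval_budget : (budget p t d).eval w a = (satLayout p t d w).budget := rfl

/-- This term, like those for the edges, copies the condition connective by connective, so that
rewriting leaves an equivalence that holds by definition. -/
theorem holds_act : Holds w a (act p t j x) ↔
    (satLayout p t d w).act (j.eval w a) (x.eval w a) := by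
  simp only [act, lit, holds_and, holds_lt, holds_eq, eval_last p t d, eval_ofNat, eval_inp,
    eval_start, eval_sub, eval_mod, eval_div, eval_const, eval_pow, eval_add]
  rfl

theorem eval_base : (base p t j x).eval w a =
    (satLayout p t d w).base (j.eval w a) (x.eval w a) := rfl

theorem eval_dig : (dig p x r).eval w a = (satLayout p t d w).dig (x.eval w a) (r.eval w a) := by
  simp only [dig, eval_mod, eval_div, eval_const, eval_pow, eval_ofNat]
  rfl

theorem holds_inner : Holds w a (inner p t d j i s) ↔
    (satLayout p t d w).Inner (j.eval w a) (i.eval w a) (s.eval w a) := by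
  simp only [inner, holds_and, holds_or, holds_not, holds_lt, holds_le, holds_eq, eval_ofNat,
    eval_add, eval_sub, eval_const, eval_rows p t d, eval_sels p t d, eval_last p t d,
    holds_act p t d, eval_dig p t d]
  rfl

theorem holds_rowEdge : Holds w a (rowEdge p t j i s j' i' s') ↔
    (satLayout p t d w).RowEdge (j.eval w a) (i.eval w a) (s.eval w a)
      (j'.eval w a) (i'.eval w a) (s'.eval w a) := by
  simp only [rowEdge, holds_and, holds_or, holds_lt, holds_eq, eval_ofNat, eval_add,
    eval_rows p t d]
  rfl

theorem holds_selectorEdge : Holds w a (selectorEdge p t d j i s j' i' s') ↔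
    (satLayout p t d w).SelectorEdge (j.eval w a) (i.eval w a) (s.eval w a)
      (j'.eval w a) (i'.eval w a) (s'.eval w a) := by
  simp only [selectorEdge, holds_and, holds_or, holds_lt, holds_le, holds_eq, eval_ofNat, eval_add,
    eval_rows p t d, eval_sels p t d]
  rfl

theorem holds_checkEdge : Holds w a (checkEdge p t d j i s j' i' s') ↔
    (satLayout p t d w).CheckEdge (j.eval w a) (i.eval w a) (s.eval w a)
      (j'.eval w a) (i'.eval w a) (s'.eval w a) := by
  simp only [checkEdge, holds_and, holds_or, holds_lt, holds_le, holds_eq, eval_ofNat, eval_add,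
    eval_sub, eval_const, eval_rows p t d, eval_sels p t d, holds_act p t d, eval_dig p t d,
    eval_base p t d]
  rfl

theorem holds_edge : Holds w a (edge p t d j i s j' i' s') ↔
    (satLayout p t d w).Edge (j.eval w a) (i.eval w a) (s.eval w a)
      (j'.eval w a) (i'.eval w a) (s'.eval w a) := by
  simp only [edge, holds_and, holds_or, holds_not, holds_eq, eval_ofNat, eval_add, eval_blocks,
    holds_inner, holds_rowEdge p t d, holds_selectorEdge, holds_checkEdge]
  rfl

theorem holds_adj (u v : Term) (x y : Fin (satLayout p t d w).N) (hu : u.eval w a = x)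
    (hv : v.eval w a = y) : Holds w a (adj p t d u v) ↔ (satLayout p t d w).graph.Adj x y := by
  rw [Layout.adj_iff]
  simp only [adj, edgeNum, holds_or, holds_edge, eval_div, eval_mod, eval_blocks, hu, hv,
    eval_types p t d]
  rfl

/-- The entry of an encoded instance at the cell that the variable points to. -/
def entry : Term :=
  ite (eq .var 0) (verts p t d) (ite (eq .var 1) (budget p t d)
    (ite (lt .var (2 + verts p t d * verts p t d))
      (ite (adj p t d ((.var - 2) / verts p t d) ((.var - 2) % verts p t d)) 1 0)
      (.var - 2 - verts p t d * verts p t d)))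

end SatTerm

/-! ### The constructed instance as a table of term values -/

theorem List.range_mul_map {α : Type*} (f : ℕ → ℕ → α) (n m : ℕ) :
    (List.range (n * m)).map (fun a => f (a / m) (a % m)) =
      (List.range n).flatMap fun i => (List.range m).map (f i) := by
  rcases Nat.eq_zero_or_pos m with rfl | hm
  · simp
  induction n with
  | zero => simp
  | succ n ih =>
    rw [Nat.succ_mul, List.range_add, List.map_append, ih, List.range_succ, List.flatMap_append]
    congr 1
    simp only [List.map_map, List.flatMap_cons, List.flatMap_nil, List.append_nil]
    refine List.map_congr_left fun a ha => ?_
    have ha' : a < m := List.mem_range.mp ha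
    simp only [Function.comp]
    rw [mul_comm, Nat.mul_add_div hm, Nat.div_eq_of_lt ha', Nat.mul_add_mod, Nat.mod_eq_of_lt ha',
      add_zero]

theorem SimpleGraph.encodeAdj_eq {n : ℕ} (G : SimpleGraph (Fin n)) (f : ℕ → ℕ → ℕ)
    (hf : ∀ i j : Fin n, f i j = open Classical in if G.Adj i j then 1 else 0) :
    G.encodeAdj = (List.range (n * n)).map fun a => f (a / n) (a % n) := by
  rw [List.range_mul_map, SimpleGraph.encodeAdj, ← List.map_coe_finRange_eq_range, List.flatMap_map]
  simp only [List.map_map]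
  congr 1
  funext i
  refine List.map_congr_left fun j _ => ?_
  exact (hf i j).symm

/-- The instance of Connected Dominating Set for an input that encodes a formula. -/
def satInstance (p t d : ℕ) (w : ℕ → ℕ) : CDSInstance where
  n := (satLayout p t d w).N
  graph := (satLayout p t d w).graph
  k := (satLayout p t d w).budget

section

open RAM RAM.Term SatTerm

variable (p t d : ℕ) (w : ℕ → ℕ)

theorem eval_entry_zero : (entry p t d).eval w 0 = (satLayout p t d w).N := by
  simp [entry]

theorem eval_entry_one : (entry p t d).eval w 1 = (satLayout p t d w).budget := by
  simp [entry]

open Classical in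
theorem eval_entry_adj {x : ℕ}
    (hx : x < (satLayout p t d w).N * (satLayout p t d w).N) : (entry p t d).eval w (2 + x) =
      if Holds w (2 + x) (adj p t d ((.var - 2) / verts p t d) ((.var - 2) % verts p t d))
        then 1 else 0 := by
  have h0 : ¬ (2 + x = 0) := by omega
  have h1 : ¬ (2 + x = 1) := by omega
  have h2 : 2 + x < 2 + (satLayout p t d w).N * (satLayout p t d w).N := by omega
  simp only [entry, eval_ite, holds_eq, holds_lt, eval_var, eval_ofNat, h0, h1, if_false, eval_add,
    eval_mul, eval_verts, h2, if_true]

theorem eval_entry_arrangement (x : ℕ) : (entry p t d).eval w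
    (2 + (satLayout p t d w).N * (satLayout p t d w).N + x) = x := by
  set q := (satLayout p t d w).N * (satLayout p t d w).N with eq
  have h0 : ¬ (2 + q + x = 0) := by omega
  have h1 : ¬ (2 + q + x = 1) := by omega
  have h2 : ¬ (2 + q + x < 2 + q) := by omega
  simp only [entry, eval_ite, holds_eq, holds_lt, eval_var, eval_ofNat, h0, h1, if_false, eval_add,
    eval_mul, eval_verts, eval_sub, ← eq, h2]
  omega

theorem encode_satInstance : (satInstance p t d w).encode =
    (List.range ((2 + verts p t d * verts p t d).eval w 0)).map fun a =>
      (entry p t d).eval w a := by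
  classical
  have hN : (2 + verts p t d * verts p t d).eval w 0 =
    2 + (satLayout p t d w).N * (satLayout p t d w).N := rfl
  rw [hN, List.range_add, List.map_append, CDSInstance.encode]
  have h2 : (List.range 2).map (fun a => (entry p t d).eval w a) =
      [(satLayout p t d w).N, (satLayout p t d w).budget] := by
    simp [List.range_succ, eval_entry_zero, eval_entry_one]
  rw [h2, List.cons_append, List.cons_append, List.nil_append]
  change (satLayout p t d w).N :: (satLayout p t d w).budget ::
    (satLayout p t d w).graph.encodeAdj = _
  congr 2
  rw [SimpleGraph.encodeAdj_eq _ (fun i j => if h : i < (satLayout p t d w).N ∧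
    j < (satLayout p t d w).N then if (satLayout p t d w).graph.Adj ⟨i, h.1⟩ ⟨j, h.2⟩ then 1 else 0
    else 0) (fun i j => by simp), List.map_map]
  refine List.map_congr_left fun x hx => ?_
  have hx' := List.mem_range.mp hx
  have hpos : 0 < (satLayout p t d w).N := Nat.pos_of_ne_zero fun h => by simp [h] at hx'
  have h3 : x / (satLayout p t d w).N < (satLayout p t d w).N :=
    (Nat.div_lt_iff_lt_mul hpos).mpr hx'
  have h4 : x % (satLayout p t d w).N < (satLayout p t d w).N := Nat.mod_lt _ hpos
  simp only [Function.comp]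
  rw [eval_entry_adj p t d w hx', dif_pos ⟨h3, h4⟩]
  refine if_congr (holds_adj p t d w _ _ _ ⟨_, h3⟩ ⟨_, h4⟩ ?_ ?_).symm rfl rfl
  · simp
  · simp

/-- The arrangement is the order of the vertex numbers, so the same `entry` continues past the
adjacency matrix and only the length term grows. -/
theorem encode_satInstance_arrangement :
    (satInstance p t d w).encode ++
      (List.finRange (satInstance p t d w).n).map (fun i => ((Equiv.refl (Fin _)) i : ℕ)) =
    (List.range ((2 + verts p t d * verts p t d + verts p t d).eval w 0)).map fun a =>
      (entry p t d).eval w a := by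
  have hN : (2 + verts p t d * verts p t d + verts p t d).eval w 0 =
    2 + (satLayout p t d w).N * (satLayout p t d w).N + (satLayout p t d w).N := rfl
  rw [encode_satInstance, hN, List.range_add, List.map_append]
  congr 1
  rw [List.map_map]
  have h : ((fun a => (entry p t d).eval w a) ∘
      fun x => 2 + (satLayout p t d w).N * (satLayout p t d w).N + x) = id :=
    funext fun x => eval_entry_arrangement p t d w x
  rw [h, List.map_id, ← List.map_coe_finRange_eq_range]
  rfl

end

/-! # The lower bound -/

open Filter Topology in
-- The input size counts only the binary digits of the number of variables, which may thus be
-- exponential in the size. A polynomial factor in that number must therefore be absorbed by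
-- slightly raising the base.
theorem exists_mul_pow_le_of_lt {γ b : ℝ} (hγ : 0 < γ) (hb : γ < b) (c : ℕ) :
    ∃ C : ℕ, ∀ n : ℕ, ((n : ℝ) + 1) ^ c * γ ^ n ≤ C * b ^ n := by
  have hb0 : 0 < b := hγ.trans hb
  have hr : |γ / b| < 1 := by
    rw [abs_of_pos (div_pos hγ hb0)]
    exact (div_lt_one hb0).mpr hb
  obtain ⟨M, hM⟩ := (tendsto_pow_const_mul_const_pow_of_abs_lt_one c hr).bddAbove_range
  obtain ⟨C, hC⟩ := exists_nat_ge (M / (γ / b))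
  refine ⟨C, fun n => ?_⟩
  have h : ((n + 1 : ℕ) : ℝ) ^ c * (γ / b) ^ (n + 1) ≤ M := hM ⟨n + 1, rfl⟩
  have h' : ((n : ℝ) + 1) ^ c * (γ / b) ^ n ≤ C := by
    refine le_trans ?_ hC
    rw [le_div_iff₀ (div_pos hγ hb0), mul_assoc, ← pow_succ]
    exact_mod_cast h
  rw [div_pow, ← mul_div_assoc, div_le_iff₀ (pow_pos hb0 n)] at h'
  exact h'

theorem exists_pow_le_pow_of_lt_three {β : ℝ} (h1 : 1 ≤ β) (h3 : β < 3) :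
    ∃ (p t : ℕ) (γ : ℝ), 0 < t ∧ 2 ^ t ≤ 3 ^ p ∧ 1 ≤ γ ∧ γ < 2 ∧ β ^ p = γ ^ t := by
  -- Rounding `3 ^ p` down to a power of two loses less than a factor `2`. So `p` is chosen with `β
  -- ^ p < 3 ^ p / 2`, which gives `β ^ p < 2 ^ t` and hence `γ < 2`.
  obtain ⟨p, hp⟩ := exists_pow_lt_of_lt_one (show (0 : ℝ) < 1 / 2 by norm_num)
    (show β / 3 < 1 by linarith)
  have hp0 : p ≠ 0 := by
    rintro rfl
    norm_num at hp
  have ht : Nat.log 2 (3 ^ p) ≠ 0 := by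
    have h : 2 ≤ 3 ^ p := le_trans (by norm_num) (Nat.le_self_pow hp0 3)
    exact (Nat.log_pos one_lt_two h).ne'
  have hβ : 1 ≤ β ^ p := one_le_pow₀ h1
  set t := Nat.log 2 (3 ^ p) with htdef
  have hγ : ((β ^ p) ^ ((t : ℝ)⁻¹)) ^ t = β ^ p := Real.rpow_inv_natCast_pow (by positivity) ht
  refine ⟨p, t, (β ^ p) ^ ((t : ℝ)⁻¹), Nat.pos_of_ne_zero ht,
    Nat.pow_log_le_self 2 (by positivity), Real.one_le_rpow hβ (by positivity), ?_, hγ.symm⟩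
  refine lt_of_pow_lt_pow_left₀ t zero_le_two ?_
  have h3p : ((3 ^ p : ℕ) : ℝ) < ((2 ^ (t + 1) : ℕ) : ℝ) :=
    Nat.cast_lt.mpr (Nat.lt_pow_succ_log_self one_lt_two _)
  push_cast at h3p
  rw [hγ]
  rw [div_pow, div_lt_iff₀ (by positivity)] at hp
  rw [pow_succ] at h3p
  linarith

theorem ParamProblem.SolvableInOStar.mono {P : ParamProblem} {b b' : ℝ}
    (h : P.SolvableInOStar b) (hb : 0 ≤ b) (hbb : b ≤ b') : P.SolvableInOStar b' := by
  obtain ⟨p, C, c, H⟩ := h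
  refine ⟨p, C, c, fun x => ?_⟩
  obtain ⟨t, s, h1, h2, h3⟩ := H x
  refine ⟨t, s, h1, h2, h3.trans ?_⟩
  gcongr

/-- A run costs at least `1`, while for parameter `1` the bound is a nonnegative multiple of `b`.
This disposes of `ε ≥ 3`. -/
theorem ParamProblem.SolvableInOStar.pos {P : ParamProblem} {b : ℝ} (h : P.SolvableInOStar b)
    (x : P.Inst) (hx : P.param x = 1) : 0 < b := by
  obtain ⟨p, C, c, H⟩ := h
  obtain ⟨t, s, h1, -, h3⟩ := H x
  by_contra! hb
  have ht : (1 : ℝ) ≤ t := Nat.one_le_cast.mpr h1.one_le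
  rw [hx, pow_one] at h3
  have : (C : ℝ) * (P.size x : ℝ) ^ c * b ≤ 0 := mul_nonpos_of_nonneg_of_nonpos (by positivity) hb
  linarith

theorem List.length_le_sum_map {α : Type*} (l : List α) {f : α → ℕ} (hf : ∀ a, 1 ≤ f a) :
    l.length ≤ (l.map f).sum := by
  induction l with
  | nil => simp
  | cons a l ih =>
    have := hf a
    simp only [List.length_cons, List.map_cons, List.sum_cons]
    omega

theorem ParamProblem.length_encode_le_size (P : ParamProblem) (x : P.Inst) :
    (P.encode x).length ≤ P.size x := by
  simpa [ParamProblem.size] using List.length_le_sum_map (P.encode x) RAM.one_le_bitLen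

theorem CNFFormula.length_clauses_le (φ : CNFFormula) :
    φ.clauses.length + 2 ≤ φ.encode.length := by
  simp only [CNFFormula.encode, List.length_cons, List.length_flatMap, List.length_map]
  have := List.length_le_sum_map φ.clauses (f := fun C => C.length + 1) fun C => Nat.le_add_left _ _
  omega

theorem CNFFormula.le_of_mem_encode (φ : CNFFormula) {d : ℕ} (hd : ∀ C ∈ φ.clauses, C.length ≤ d)
    {y : ℕ} (hy : y ∈ φ.encode) : y ≤ φ.clauses.length ∨ y ≤ (d + 2) * (φ.numVars + 1) := by
  have e : (d + 2) * (φ.numVars + 1) = d * φ.numVars + 2 * φ.numVars + d + 2 := by ring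
  simp only [CNFFormula.encode, List.mem_cons, List.mem_flatMap, List.mem_map] at hy
  rcases hy with rfl | rfl | ⟨C, hC, rfl | ⟨l, -, rfl⟩⟩
  · right; omega
  · left; exact le_rfl
  · have := hd C hC
    right; omega
  · have := l.1.isLt
    have := Bool.toNat_le l.2
    right; omega

/-- A reduction from `d`-SAT that turns `t` variables into `p` units of the parameter. -/
theorem SETH.not_solvableInOStar (hSETH : SETH) (Q : ParamProblem) {β : ℝ} (h1 : 1 ≤ β)
    (h3 : β < 3)
    (hred : ∀ p t d : ℕ, 0 < t → 2 ^ t ≤ 3 ^ p →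
      ∃ (f : (satProblem d).Inst → Q.Inst) (l e : RAM.Term) (C₀ : ℕ),
        (∀ φ, Q.encode (f φ) = (List.range (l.eval φ.1.input 0)).map fun a => e.eval φ.1.input a) ∧
        (∀ φ, Q.IsYes (f φ) ↔ φ.1.Satisfiable) ∧
        ∀ φ, Q.param (f φ) ≤ (φ.1.numVars / t + 1) * p + C₀) :
    ¬ Q.SolvableInOStar β := by
  intro hQ
  obtain ⟨p, t, γ, ht, hpt, hγ1, hγ2, hβγ⟩ := exists_pow_le_pow_of_lt_three h1 h3
  -- The target base `(γ + 2) / 2` lies strictly between `γ` and `2`; the gap to `γ` absorbs powers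
  -- of the number of variables.
  obtain ⟨d, hd⟩ := hSETH (2 - (γ + 2) / 2) (by linarith)
  apply hd
  rw [sub_sub_cancel]
  obtain ⟨f, l, e, C₀, hf, hyes, hparam⟩ := hred p t d ht hpt
  obtain ⟨q, C, c, H⟩ := hQ.of_fill (P := satProblem d) (zero_le_one.trans h1) f l e hf hyes
    fun x => one_le_pow₀ h1
  obtain ⟨C₁, hC₁⟩ := exists_mul_pow_le_of_lt (b := (γ + 2) / 2) (zero_lt_one.trans_le hγ1)
    (by linarith) c
  obtain ⟨C₂, hC₂⟩ := exists_nat_ge (β ^ C₀ * γ ^ t)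
  refine ⟨q, C * (d + 2) ^ c * C₂ * C₁, c, fun φ => ?_⟩
  have hlen := φ.1.length_clauses_le.trans ((satProblem d).length_encode_le_size φ)
  obtain ⟨S, hS⟩ : ∃ S, S = (satProblem d).size φ := ⟨_, rfl⟩
  rw [← hS] at hlen ⊢
  -- A bound for all numbers of the input: `S` covers the number of clauses, and the other factor
  -- covers the number of variables, the clause lengths and the literals.
  obtain ⟨τ, s, k1, k2, k3⟩ := H φ (S * ((d + 2) * (φ.1.numVars + 1))) 
    (le_trans (show 2 ≤ S by omega) (Nat.le_mul_of_pos_right _ (by positivity))) (by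
    intro y hy
    rcases φ.1.le_of_mem_encode φ.2 hy with h | h
    · exact (show y ≤ S by omega).trans (Nat.le_mul_of_pos_right _ (by positivity))
    · exact h.trans (Nat.le_mul_of_pos_left _ (by omega)))
  refine ⟨τ, s, k1, k2, k3.trans ?_⟩
  change _ ≤ _ * _ * ((γ + 2) / 2) ^ φ.1.numVars
  set n := φ.1.numVars
  have hpow : β ^ Q.param (f φ) ≤ C₂ * γ ^ n := by
    calc β ^ Q.param (f φ) ≤ β ^ ((n / t + 1) * p + C₀) := pow_le_pow_right₀ h1 (hparam φ)
      _ = β ^ C₀ * (γ ^ t) ^ (n / t + 1) := by rw [pow_add, mul_comm _ p, pow_mul, hβγ, mul_comm]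
      _ = β ^ C₀ * γ ^ t * γ ^ (t * (n / t)) := by rw [← pow_mul, mul_add, pow_add, mul_one]; ring
      _ ≤ C₂ * γ ^ n := by
        have := pow_le_pow_right₀ hγ1 (Nat.mul_div_le n t)
        gcongr
  have hn := hC₁ n
  push_cast
  calc (C : ℝ) * (S * ((d + 2) * (n + 1))) ^ c * β ^ Q.param (f φ)
      ≤ (C : ℝ) * (S * ((d + 2) * (n + 1))) ^ c * (C₂ * γ ^ n) := by gcongr
    _ = C * (d + 2) ^ c * C₂ * S ^ c * ((n + 1) ^ c * γ ^ n) := by rw [mul_pow, mul_pow]; ring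
    _ ≤ C * (d + 2) ^ c * C₂ * S ^ c * (C₁ * ((γ + 2) / 2) ^ n) := by gcongr
    _ = _ := by ring

theorem SETH.not_solvableInOStar_of_lt_three (hSETH : SETH) (Q : ParamProblem) {β : ℝ}
    (h3 : β < 3) (x : Q.Inst) (hx : Q.param x = 1)
    (hred : ∀ p t d : ℕ, 0 < t → 2 ^ t ≤ 3 ^ p →
      ∃ (f : (satProblem d).Inst → Q.Inst) (l e : RAM.Term) (C₀ : ℕ),
        (∀ φ, Q.encode (f φ) = (List.range (l.eval φ.1.input 0)).map fun a => e.eval φ.1.input a) ∧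
        (∀ φ, Q.IsYes (f φ) ↔ φ.1.Satisfiable) ∧
        ∀ φ, Q.param (f φ) ≤ (φ.1.numVars / t + 1) * p + C₀) :
    ¬ Q.SolvableInOStar β := fun hQ =>
  hSETH.not_solvableInOStar Q (le_max_right β 1) (max_lt h3 (by norm_num)) hred
    (hQ.mono (hQ.pos x hx).le (le_max_left β 1))

theorem isYes_satInstance_iff {p t d : ℕ} (ht : 0 < t) (hpt : 2 ^ t ≤ 3 ^ p)
    (φ : (satProblem d).Inst) : (satInstance p t d φ.1.input).IsYes ↔ φ.1.Satisfiable :=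
  ⟨fun ⟨_, hS, hcard⟩ => satisfiable_of_isConnectedDominatingSet φ.1 ht hS hcard,
    fun h => exists_isConnectedDominatingSet_of_satisfiable φ.1 ht hpt φ.2 h⟩

/-- An upper bound for the cutwidth of `satInstance` beyond the number of rows. -/
def cutExcess (p d : ℕ) : ℕ :=
  1 + ((8 + 2 * p) * (8 + 2 * p) + (d * 3 ^ p + d * 3 ^ p * (8 + 2 * p)))

theorem arrangementCutwidth_completeGraph_two (ℓ : Fin 2 ≃ Fin 2) :
    (⊤ : SimpleGraph (Fin 2)).arrangementCutwidth ℓ = 1 := by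
  have h0 : (⊤ : SimpleGraph (Fin 2)).arrangementCut ℓ 0 = {s(ℓ 0, ℓ 1)} := by
    ext e
    simp only [SimpleGraph.arrangementCut, Set.mem_ofPred_eq, Set.mem_singleton_iff]
    constructor
    · rintro ⟨-, j, k, hj, hk, rfl⟩
      obtain rfl : j = 0 := by omega
      obtain rfl : k = 1 := by omega
      rfl
    · rintro rfl
      exact ⟨by simp, 0, 1, le_rfl, by simp, rfl⟩
  have h1 : (⊤ : SimpleGraph (Fin 2)).arrangementCut ℓ 1 = ∅ := by
    ext e
    simp only [SimpleGraph.arrangementCut, Set.mem_ofPred_eq, Set.mem_empty_iff_false, iff_false]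
    rintro ⟨-, j, k, hj, hk, rfl⟩
    omega
  rw [SimpleGraph.arrangementCutwidth, Fin.univ_succ]
  simp [h0, h1]

/-- Assuming SETH, Connected Dominating Set cannot be solved in time `O*((3 - ε) ^ ctw)` for any
`ε > 0`, even if a linear arrangement of cutwidth `ctw` is given with the input. -/
theorem mainTheorem7 (hSETH : SETH) :
    (∀ ε : ℝ, 0 < ε → ¬ cdsProblem.SolvableInOStar (3 - ε)) ∧
    (∀ ε : ℝ, 0 < ε → ¬ cdsWithArrangementProblem.SolvableInOStar (3 - ε)) := by
  constructor
  · intro ε hε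
    -- A single edge serves as the instance of parameter `1` that forces the base to be positive.
    refine hSETH.not_solvableInOStar_of_lt_three _ (by linarith) (⟨2, ⊤, 0⟩ : CDSInstance) ?_ ?_
    · change (⊤ : SimpleGraph (Fin 2)).cutwidth = 1
      simp [SimpleGraph.cutwidth, arrangementCutwidth_completeGraph_two]
    · intro p t d ht hpt
      exact ⟨fun φ => satInstance p t d φ.1.input, _, _, cutExcess p d,
        fun φ => encode_satInstance p t d φ.1.input, isYes_satInstance_iff ht hpt,
        fun φ => (satLayout p t d φ.1.input).cutwidth_le (satLayout_base_lt φ.1)⟩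
  · intro ε hε
    refine hSETH.not_solvableInOStar_of_lt_three _ (by linarith)
      (⟨⟨2, ⊤, 0⟩, Equiv.refl _⟩ : Σ x : CDSInstance, Fin x.n ≃ Fin x.n)
      (arrangementCutwidth_completeGraph_two _) ?_
    intro p t d ht hpt
    exact ⟨fun φ => ⟨satInstance p t d φ.1.input, Equiv.refl _⟩, _, _, cutExcess p d,
      fun φ => encode_satInstance_arrangement p t d φ.1.input, isYes_satInstance_iff ht hpt,
      fun φ => (satLayout p t d φ.1.input).arrangementCutwidth_le (satLayout_base_lt φ.1)⟩
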